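/- For an integer $N\ge 1$ and real $\beta>0$, $M>N-1$, let $\lambda_1,\dots,\lambda_N$ be distributed as the $\beta$-Laguerre ensemble, i.e. with joint density on $(0,\infty)^N$ proportional to \[ \prod_{i<j}|\lambda_j-\lambda_i|^{\beta}\prod_{i=1}^N \lambda_i^{\frac{\beta}{2}(M-N+1)-1}e^{-\frac{\beta M}{2}\lambda_i}, \] let $L_N=\frac1N\sum_{i=1}^N\delta_{\lambda_i}$ be the empirical distribution, and write $\langle L_N,p\rangle=\int p\,dL_N$. This density is normalizable, and $\langle L_N,p\rangle$ is square integrable for every real polynomial $p$. Let $\gamma\in(0,1)$ and let $p$ be a real polynomial of degree $m$ (with $m=0$ if $p=0$). There are real polynomials $\ell_{p;k}$, $2\le k\le 2m+1$, depending only on $p$ and $\gamma$, with $\deg \ell_{p;k}\le k-2$, such that for $M=N/\gamma$, all $N\ge1$ and all $\beta>0$, \[ \operatorname{Var}[\langle L_N,p\rangle]=\sum_{k=2}^{2m+1}\frac{\beta\,\ell_{p;k}(\beta)}{(\beta N)^k}. \] Moreover, let $\beta=\beta_N>0$ and $M=M_N>N-1$ vary with $N$ so that $N/M_N\to\gamma$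 as $N\to\infty$. (i) If $\beta N\to\infty$, then $\beta N^2\operatorname{Var}[\langle L_N,p\rangle]\to\sigma_p^2$, where, with $\gamma_\pm=(1\pm\sqrt\gamma)^2$ and $\gamma_m=1+\gamma$, \[ \sigma_p^2=\frac1{2\pi^2}\int_{\gamma_-}^{\gamma_+}\!\int_{\gamma_-}^{\gamma_+}\left(\frac{p(y)-p(x)}{y-x}\right)^2\frac{4\gamma-(x-\gamma_m)(y-\gamma_m)}{\sqrt{4\gamma-(x-\gamma_m)^2}\,\sqrt{4\gamma-(y-\gamma_m)^2}}\,dx\,dy . \] (ii) If $\beta N\to 2c$ with $c\in(0,\infty)$, then $\beta N^2\operatorname{Var}[\langle L_N,p\rangle]\to\sigma_{p,c}^2$, where \[ \sigma_{p,c}^2=\sum_{k=2}^{2m+1}\frac{\ell_{p;k}(0)}{(2c)^{k-2}} \] depends only on $p$, $\gamma$ and $c$. -/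

import Mathlib

open MeasureTheory ProbabilityTheory Filter Topology

noncomputable section

/-- The unnormalized joint density
`∏_{i<j} |x_j - x_i|^β * ∏_i x_i^{β(M-N+1)/2 - 1} e^{-β M x_i / 2}` of the `β`-Laguerre ensemble. -/
def laguerreWeight (N : ℕ) (β M : ℝ) (x : Fin N → ℝ) : ℝ :=
  (∏ i, ∏ j ∈ Finset.Ioi i, |x j - x i| ^ β) *
    ∏ i, (x i ^ (β / 2 * (M - N + 1) - 1) * Real.exp (-(β * M / 2) * x i))

/-- The measure on `(0,∞)^N` with density `laguerreWeight N β M`. -/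
def laguerreUnnormalized (N : ℕ) (β M : ℝ) : Measure (Fin N → ℝ) :=
  (volume.restrict {x | ∀ i, 0 < x i}).withDensity
    (fun x => ENNReal.ofReal (laguerreWeight N β M x))

/-- The law of the particles of the `β`-Laguerre ensemble: the measure above divided by its total
mass, which is the normalizing constant. -/
def laguerreEnsemble (N : ℕ) (β M : ℝ) : Measure (Fin N → ℝ) :=
  (laguerreUnnormalized N β M Set.univ)⁻¹ • laguerreUnnormalized N β M

/-- The empirical distribution `N⁻¹ ∑ δ_{x_i}` of a configuration of `N` points. -/
def empiricalMeasure {N : ℕ} (x : Fin N → ℝ) : Measure ℝ :=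
  (N : ENNReal)⁻¹ • ∑ i, Measure.dirac (x i)

/-- The linear statistic `⟨L_N, p⟩ = ∫ p dL_N`, as a function of the configuration. -/
def linearStatistic (N : ℕ) (p : Polynomial ℝ) (x : Fin N → ℝ) : ℝ :=
  ∫ y, p.eval y ∂(empiricalMeasure x)

/-- `Var⟨L_N, p⟩` for the `β`-Laguerre ensemble with parameters `N, β, M`. -/
def varLN (N : ℕ) (β M : ℝ) (p : Polynomial ℝ) : ℝ :=
  variance (linearStatistic N p) (laguerreEnsemble N β M)

/-- The limiting variance `σ_f²` of the regime `β N → ∞`; here `(1 ∓ √γ)²` are the end points of the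
Marchenko--Pastur distribution and `1 + γ` is their midpoint. -/
def sigmaSq (γ : ℝ) (f : ℝ → ℝ) : ℝ :=
  1 / (2 * Real.pi ^ 2) *
    ∫ x in ((1 - √γ) ^ 2)..((1 + √γ) ^ 2), ∫ y in ((1 - √γ) ^ 2)..((1 + √γ) ^ 2),
      ((f y - f x) / (y - x)) ^ 2 *
        ((4 * γ - (x - (1 + γ)) * (y - (1 + γ))) /
          (√(4 * γ - (x - (1 + γ)) ^ 2) * √(4 * γ - (y - (1 + γ)) ^ 2)))

/-- The limiting variance `σ_{p,c}²` of the regime `β N → 2c`, in terms of the polynomials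
`ℓ_{p;k}` of the expansion of the variance and of the degree `m` of `p`:
`∑_{k=2}^{2m+1} ℓ_{p;k}(0) / (2c)^{k-2}`. -/
def sigmaSqOfExpansion (ℓ : ℕ → Polynomial ℝ) (m : ℕ) (c : ℝ) : ℝ :=
  ∑ k ∈ Finset.Icc 2 (2 * m + 1), (ℓ k).eval 0 / (2 * c) ^ (k - 2)

end

/-!
The moments of the power sums of the `β`-Laguerre ensemble satisfy a closed recursion, the loop
equations, and everything is read off from it. Write `u_k = N⁻¹ ∑ x_i ^ k`, `g = N / M`,
`h = 1 / (βN)`, `n = 1 / N`. Integrating the divergence of the vector field `x_i ^ (k+1) F` against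
the density gives, for every polynomial `F` in the `u_j`,

  `E[u_{k+1} F] = g ∑_{l ≤ k} E[u_l u_{k-l} F] + ((1 - g) + k g (2h - n)) E[u_k F]`
  `                + 2 g h n ∑_j j E[u_{k+j} ∂F/∂u_j]`.

The total degree drops by one, so all mixed moments are polynomials `loopMoment g h n` in `g, h, n`
(`laguerreMean_powerSumProduct`). Modulo `h n` the recursion has no derivative term, so its solution
is multiplicative; hence covariances are `h n` times a polynomial `loopCov g h n`
(`loopMoment_append`, `varLN_eq`).

* The expansion in powers of `(βN)⁻¹` for `M = N / γ` comes from the substitution `n = β h` and a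
  count of degrees in `h` (`natDegree_loopMoment_le`, `exists_expansion`).
* Since `β N² Var = ∑ p_a p_b loopCov g h n [a] [b]` is jointly continuous in `(g, h, n)` and `n → 0`,
  both limits are values of this polynomial, at `(γ, 0, 0)` and at `(γ, 1 / (2c), 0)`.
* At `h = n = 0` the recursion says that the covariance form `limitCov` satisfies
  `limitCov (Λ ψ) q = 2γ m(x ψ q')`, where `m` is the moment functional of the limiting
  (Marchenko--Pastur) law and `Λ` an explicit operator. In the coordinate
  `z = (x - 1 - γ) / (2√γ)` one has `Λ U_k(z) = 2√γ T_{k+1}(z)`, and the `U_k(z)` are orthonormal for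
  `m(x ·)`; so the Chebyshev polynomials diagonalize the form: `limitCov T_a T_b = (a/2) δ_{ab}`
  (`limitCov_shiftedT`).
* The double integral `sigmaSq` has the same diagonalization: with `x = 1 + γ + 2√γ cos θ` it becomes
  an integral of squares of trigonometric polynomials, because of
  `1 - zw = ((1 - z²) + (1 - w²) + (z - w)²) / 2` and an explicit Fourier expansion of
  `(cos aθ - cos aφ) sin θ / (cos θ - cos φ)` (`sigmaSq_sum_shiftedT`).

The integration by parts is done for the weight with `|x_j - x_i| ^ β` replaced by
`((x_j - x_i)² + ε) ^ (β/2)`, whose logarithmic derivative is bounded near the diagonals for all `β > 0`;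
after summation over the coordinates the singular terms combine to divided differences, and `ε → 0`
by dominated convergence (`integral_divergence_eq_zero`).
-/

/-! ### The loop recursion in a commutative ring -/

section LoopEquations

variable {R S : Type*} [CommRing R] [CommRing S]

theorem sum_eraseIdx_add_getElem (L : List ℕ) (i : ℕ) (hi : i < L.length) :
    (L.eraseIdx i).sum + L[i] = L.sum := by
  have := (List.getElem_cons_eraseIdx_perm hi).sum_eq
  rw [← this]; simp [add_comm]

/-- The solution of the loop equations: `loopMoment g h n [k₁, …, k_r]` is the value of
`E[u_{k₁} ⋯ u_{k_r}]` prescribed by the recursion, as an element of any commutative ring. Lists stand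
for monomials, and the recursion always reduces the head of the list. -/
def loopMoment (g h n : R) : List ℕ → R
  | [] => 1
  | 0 :: L => loopMoment g h n L
  | (k + 1) :: L =>
    g * ∑ l : Fin (k + 1), loopMoment g h n ((l : ℕ) :: (k - l) :: L) +
      ((1 - g) + k * g * (2 * h - n)) * loopMoment g h n (k :: L) +
      2 * g * h * n *
        ∑ i : Fin L.length, (L[i] : R) * loopMoment g h n ((k + L[i]) :: L.eraseIdx i)
termination_by L => (L.sum, L.length)
decreasing_by
  · simp [Prod.lex_def]
  · have := l.2; simp [Prod.lex_def]; omega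
  · simp [Prod.lex_def]
  · have := sum_eraseIdx_add_getElem L i i.2
    simp only [Prod.lex_def, List.sum_cons, Fin.getElem_fin]; omega

/-- The quotient by `h n` of `E[u_L u_{L'}] - E[u_L] E[u_{L'}]`, by its own recursion, which makes sense
also where `h n` is a zero divisor. The last sum is the part of the derivative term that acts
on `L'`; it carries no factor `h n`. -/
def loopCov (g h n : R) : List ℕ → List ℕ → R
  | [], _ => 0
  | 0 :: L, L' => loopCov g h n L L'
  | (k + 1) :: L, L' =>
    g * ∑ l : Fin (k + 1), loopCov g h n ((l : ℕ) :: (k - l) :: L) L' +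
      ((1 - g) + k * g * (2 * h - n)) * loopCov g h n (k :: L) L' +
      2 * g * h * n *
        ∑ i : Fin L.length, (L[i] : R) * loopCov g h n ((k + L[i]) :: L.eraseIdx i) L' +
      2 * g *
        ∑ i : Fin L'.length, (L'[i] : R) * loopMoment g h n ((k + L'[i]) :: (L ++ L'.eraseIdx i))
termination_by L => (L.sum, L.length)
decreasing_by
  · simp [Prod.lex_def]
  · have := l.2; simp [Prod.lex_def]; omega
  · simp [Prod.lex_def]
  · have := sum_eraseIdx_add_getElem L i i.2
    simp only [Prod.lex_def, List.sum_cons, Fin.getElem_fin]; omega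

theorem loopMoment_nil (g h n : R) : loopMoment g h n [] = 1 := by rw [loopMoment]

theorem loopMoment_zero_cons (g h n : R) (L : List ℕ) :
    loopMoment g h n (0 :: L) = loopMoment g h n L := by rw [loopMoment]

theorem sum_getElem_append (f : ℕ → List ℕ → R) (L L' : List ℕ) :
    ∑ i : Fin (L ++ L').length, f (L ++ L')[i] ((L ++ L').eraseIdx i) =
      ∑ i : Fin L.length, f L[i] (L.eraseIdx i ++ L') +
        ∑ i : Fin L'.length, f L'[i] (L ++ L'.eraseIdx i) := by
  have e : (L ++ L').length = L.length + L'.length := List.length_append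
  rw [← (finCongr e.symm).sum_comp, Fin.sum_univ_add]
  congr 1
  · refine Finset.sum_congr rfl fun i _ => ?_
    simp [List.getElem_append_left, List.eraseIdx_append_of_lt_length]
  · refine Finset.sum_congr rfl fun i _ => ?_
    simp [List.getElem_append_right, List.eraseIdx_append_of_length_le]

/-- Moments factorize up to a multiple of `h n`. -/
theorem loopMoment_append (g h n : R) (L L' : List ℕ) :
    loopMoment g h n (L ++ L') =
      loopMoment g h n L * loopMoment g h n L' + h * n * loopCov g h n L L' := by
  fun_induction loopCov g h n L L' with
  | case1 L' => simp [loopMoment_nil]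
  | case2 L' L ih => rw [List.cons_append, loopMoment_zero_cons, ih, loopMoment_zero_cons]
  | case3 k L L' ih1 ih2 ih3 =>
    rw [List.cons_append, loopMoment, loopMoment.eq_3 g h n k L,
      sum_getElem_append (fun a K => (a : R) * loopMoment g h n ((k + a) :: K))]
    simp only [List.cons_append] at ih1 ih2 ih3
    simp only [ih1, ih2, ih3]
    have key : ∀ {m : ℕ} (w a c : Fin m → R) (x : R),
        ∑ i, w i * (a i * x + h * n * c i) = (∑ i, w i * a i) * x + h * n * ∑ i, w i * c i := by
      intro m w a c x
      rw [Finset.sum_mul, Finset.mul_sum, ← Finset.sum_add_distrib]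
      exact Finset.sum_congr rfl fun i _ => by ring
    have key' : ∀ {m : ℕ} (a c : Fin m → R) (x : R),
        ∑ i, (a i * x + h * n * c i) = (∑ i, a i) * x + h * n * ∑ i, c i := by
      intro m a c x
      simpa using key (fun _ => 1) a c x
    rw [key', key]
    ring

theorem map_loopMoment (φ : R →+* S) (g h n : R) (L : List ℕ) :
    φ (loopMoment g h n L) = loopMoment (φ g) (φ h) (φ n) L := by
  fun_induction loopMoment g h n L with
  | case1 => simp [loopMoment_nil]
  | case2 L ih => rw [ih, loopMoment_zero_cons]
  | case3 k L ih1 ih2 ih3 => 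
    simp only [Fin.getElem_fin] at ih3
    rw [loopMoment]
    simp [ih1, ih2, ih3, map_ofNat φ 2]

theorem map_loopCov (φ : R →+* S) (g h n : R) (L L' : List ℕ) :
    φ (loopCov g h n L L') = loopCov (φ g) (φ h) (φ n) L L' := by
  fun_induction loopCov g h n L L' with
  | case1 L' => simp [loopCov]
  | case2 L' L ih => rw [ih, loopCov]
  | case3 k L L' ih1 ih2 ih3 => 
    simp only [Fin.getElem_fin] at ih3
    rw [loopCov]
    simp [ih1, ih2, ih3, map_loopMoment, map_ofNat φ 2]

theorem loopCov_mem (A : Subring R) {g h n : R} (hg : g ∈ A) (hh : h ∈ A) (hn : n ∈ A)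
    (L L' : List ℕ) : loopCov g h n L L' ∈ A := by
  have := map_loopCov A.subtype ⟨g, hg⟩ ⟨h, hh⟩ ⟨n, hn⟩ L L'
  simp only [Subring.subtype_apply] at this
  rw [← this]
  exact Subtype.property _

/-- Continuity holds because the recursion can be run in the ring `C(ℝ × ℝ × ℝ, ℝ)`. -/
theorem continuous_loopCov (L L' : List ℕ) :
    Continuous fun x : ℝ × ℝ × ℝ => loopCov x.1 x.2.1 x.2.2 L L' := by
  let g : C(ℝ × ℝ × ℝ, ℝ) := ⟨fun x => x.1, by fun_prop⟩
  let h : C(ℝ × ℝ × ℝ, ℝ) := ⟨fun x => x.2.1, by fun_prop⟩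
  let n : C(ℝ × ℝ × ℝ, ℝ) := ⟨fun x => x.2.2, by fun_prop⟩
  convert (loopCov g h n L L').continuous with x
  have := map_loopCov (Pi.evalRingHom (fun _ : ℝ × ℝ × ℝ => ℝ) x |>.comp
    ContinuousMap.coeFnRingHom) g h n L L'
  exact this.symm

open Polynomial in
/-- If `h` and `n` have degree one, each step of the recursion keeps `sum + length - 1` balanced: splitting
trades degree for a factor, the linear term costs one power, and merging two factors costs two. -/
theorem natDegree_loopMoment_le {g h n : Polynomial R} (hg : g.natDegree = 0)
    (hh : h.natDegree ≤ 1) (hn : n.natDegree ≤ 1) (L : List ℕ) :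
    (loopMoment g h n L).natDegree ≤ L.sum + L.length - 1 := by
  fun_induction loopMoment g h n L with
  | case1 => simp
  | case2 L ih => simp only [List.sum_cons, List.length_cons]; omega
  | case3 k L ih1 ih2 ih3 =>
    simp only [List.sum_cons, List.length_cons] at *
    refine natDegree_add_le_of_degree_le (natDegree_add_le_of_degree_le ?_ ?_) ?_
    · refine natDegree_mul_le.trans ?_
      rw [hg, zero_add]
      refine natDegree_sum_le_of_forall_le _ _ fun l _ => (ih1 l).trans ?_
      have := l.2; omega
    · have h1 : ((1 - g) + k * g * (2 * h - n)).natDegree ≤ 1 := by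
        refine natDegree_add_le_of_degree_le ?_ ?_
        · refine (natDegree_sub_le _ _).trans ?_
          simp [hg]
        · have a1 : (2 * h).natDegree ≤ 1 := by
            refine natDegree_mul_le.trans ?_
            have : (2 : Polynomial R).natDegree = 0 := natDegree_ofNat 2
            omega
          have a2 := (natDegree_sub_le (2 * h) n).trans (max_le a1 hn)
          have a3 : ((k : Polynomial R) * g).natDegree ≤ 0 := by
            refine natDegree_mul_le.trans ?_
            simp [hg]
          exact natDegree_mul_le.trans (by omega)
      exact natDegree_mul_le.trans (by omega)
    · by_cases h0 : L.length = 0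
      · have : L = [] := List.length_eq_zero_iff.1 h0
        subst this; simp
      have h1 : (2 * g * h * n).natDegree ≤ 2 := by
        have : (2 : Polynomial R).natDegree = 0 := natDegree_ofNat 2
        have b1 := natDegree_mul_le (p := 2) (q := g)
        have b2 := natDegree_mul_le (p := 2 * g) (q := h)
        have b3 := natDegree_mul_le (p := 2 * g * h) (q := n)
        omega
      refine natDegree_mul_le.trans ?_
      have h3 : (∑ i : Fin L.length,
          (L[i] : Polynomial R) * loopMoment g h n ((k + L[i]) :: L.eraseIdx i)).natDegree ≤
          k + L.sum + L.length - 1 := by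
        refine natDegree_sum_le_of_forall_le _ _ fun i _ => ?_
        refine natDegree_mul_le.trans ?_
        have c1 := ih3 i
        have c2 := sum_eraseIdx_add_getElem L i i.2
        have c3 := List.length_eraseIdx_of_lt i.2
        have c4 : ((L[i] : ℕ) : Polynomial R).natDegree = 0 := natDegree_natCast _
        simp only [Fin.getElem_fin] at *
        omega
      omega

end LoopEquations

/-! ### The limiting recursion and the expansion of the covariance -/

section LoopEquationsLeading

variable {R : Type*} [CommRing R]

theorem loopMoment_append_leading (g : R) (L L' : List ℕ) :
    loopMoment g 0 0 (L ++ L') = loopMoment g 0 0 L * loopMoment g 0 0 L' := by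
  simp [loopMoment_append]

theorem loopMoment_singleton_zero (g h n : R) : loopMoment g h n [0] = 1 := by
  rw [loopMoment_zero_cons, loopMoment_nil]

theorem loopMoment_singleton_succ_leading (g : R) (k : ℕ) :
    loopMoment g 0 0 [k + 1] =
      g * ∑ l ∈ Finset.range (k + 1), loopMoment g 0 0 [l] * loopMoment g 0 0 [k - l] +
        (1 - g) * loopMoment g 0 0 [k] := by
  rw [loopMoment, Finset.sum_range]
  simp only [fun (a b : ℕ) => loopMoment_append_leading g [a] [b] |>.symm, List.singleton_append]
  simp

/-- At `h = n = 0` the covariance is a derivation in its first argument. -/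
theorem loopCov_append_leading (g : R) (L L₁ L' : List ℕ) :
    loopCov g 0 0 (L ++ L₁) L' =
      loopCov g 0 0 L L' * loopMoment g 0 0 L₁ + loopMoment g 0 0 L * loopCov g 0 0 L₁ L' := by
  fun_induction loopCov g 0 0 L L' with
  | case1 L' => simp [loopMoment_nil]
  | case2 L L' ih => rw [List.cons_append, loopCov, ih, loopMoment_zero_cons]
  | case3 k L L' ih1 ih2 ih3 =>
    have hperm : ∀ i : Fin L'.length, loopMoment g 0 0 ((k + L'[i]) :: (L ++ L₁ ++ L'.eraseIdx i)) =
        loopMoment g 0 0 ((k + L'[i]) :: (L ++ L'.eraseIdx i)) * loopMoment g 0 0 L₁ := by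
      intro i
      simp only [← List.singleton_append (l := _ ++ _), loopMoment_append_leading]
      ring
    rw [List.cons_append, loopCov, loopMoment]
    simp only [List.cons_append] at ih1 ih2
    simp only [ih1, ih2, hperm, Finset.sum_add_distrib, ← Finset.sum_mul, ← mul_assoc]
    simp
    ring

theorem loopCov_singleton_zero (g h n : R) (L' : List ℕ) : loopCov g h n [0] L' = 0 := by
  rw [loopCov, loopCov]

theorem loopCov_singleton_succ_leading (g : R) (k j : ℕ) :
    loopCov g 0 0 [k + 1] [j] =
      2 * g * ∑ l ∈ Finset.range (k + 1), loopMoment g 0 0 [l] * loopCov g 0 0 [k - l] [j] +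
        (1 - g) * loopCov g 0 0 [k] [j] + 2 * g * (j * loopMoment g 0 0 [k + j]) := by
  have e : ∀ l : ℕ, loopCov g 0 0 [l, k - l] [j] =
      loopCov g 0 0 [l] [j] * loopMoment g 0 0 [k - l] +
        loopMoment g 0 0 [l] * loopCov g 0 0 [k - l] [j] :=
    fun l => loopCov_append_leading g [l] [k - l] [j]
  have r : ∑ l ∈ Finset.range (k + 1), loopCov g 0 0 [l] [j] * loopMoment g 0 0 [k - l] =
      ∑ l ∈ Finset.range (k + 1), loopMoment g 0 0 [l] * loopCov g 0 0 [k - l] [j] := by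
    rw [← Finset.sum_range_reflect]
    refine Finset.sum_congr rfl fun l hl => ?_
    have : l ≤ k := Nat.lt_succ_iff.1 (Finset.mem_range.1 hl)
    rw [show k + 1 - 1 - l = k - l by omega, show k - (k - l) = l by omega, mul_comm]
  rw [loopCov]
  simp only [e, Finset.sum_add_distrib]
  rw [← Finset.sum_range (fun l => loopCov g 0 0 [l] [j] * loopMoment g 0 0 [k - l]),
    ← Finset.sum_range (fun l => loopMoment g 0 0 [l] * loopCov g 0 0 [k - l] [j]), r]
  simp
  ring

end LoopEquationsLeading

section Expansion

open Polynomial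

/-- The polynomials in `t` over `R[X]` whose coefficient of `t ^ k` has degree at most `k` in `X`. It
contains both `t` and `X t`, which are the values of `h` and of `n = β h`. -/
def coeffDegreeSubring (R : Type*) [CommRing R] : Subring R[X][X] where
  carrier := {P | ∀ k, (P.coeff k).natDegree ≤ k}
  mul_mem' := by
    intro P Q hP hQ k
    rw [coeff_mul]
    refine natDegree_sum_le_of_forall_le _ _ fun i hi => natDegree_mul_le.trans ?_
    have := Finset.HasAntidiagonal.mem_antidiagonal.1 hi
    have h1 := hP i.1
    have h2 := hQ i.2
    omega
  one_mem' := by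
    intro k
    rw [coeff_one]; split_ifs <;> simp
  add_mem' := by
    intro P Q hP hQ k
    rw [coeff_add]
    exact natDegree_add_le_of_degree_le (hP k) (hQ k)
  zero_mem' := by simp
  neg_mem' := by
    intro P hP k
    simpa using hP k

/-- The two powers of `t` in `h n = X t²` are divided out of the bound for moments. -/
theorem degree_loopCov_lt (γ : ℝ) (a b : ℕ) :
    (loopCov (C (C γ)) X (C X * X) [a] [b] : ℝ[X][X]).degree < (a + b : ℕ) := by
  set Q : ℝ[X][X] := loopCov (C (C γ)) X (C X * X) [a] [b] with hQ
  have h := loopMoment_append (C (C γ) : ℝ[X][X]) X (C X * X) [a] [b]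
  have hX : (C X * X : ℝ[X][X]).natDegree ≤ 1 := (natDegree_C_mul_le _ _).trans natDegree_X_le
  have hd := fun L => natDegree_loopMoment_le (natDegree_C (C γ)) (natDegree_X_le (R := ℝ[X])) hX L
  by_cases h0 : Q = 0
  · rw [h0, degree_zero]; exact WithBot.bot_lt_coe _
  rw [degree_eq_natDegree h0]
  have e : X * (C X * X) * Q = C X * (Q * X ^ 2) := by ring
  have h1 : (C X * (Q * X ^ 2) : ℝ[X][X]).natDegree = Q.natDegree + 2 := by
    rw [natDegree_C_mul X_ne_zero, natDegree_mul_X_pow 2 h0]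
  have h2 : (X * (C X * X) * Q).natDegree ≤ a + b + 1 := by
    have : X * (C X * X) * Q = loopMoment (C (C γ)) X (C X * X) ([a] ++ [b]) -
        loopMoment (C (C γ)) X (C X * X) [a] * loopMoment (C (C γ)) X (C X * X) [b] := by
      rw [h]; ring
    rw [this]
    refine (natDegree_sub_le _ _).trans (max_le ?_ (natDegree_mul_le.trans ?_))
    · simpa using hd [a, b]
    · have h3 := hd [a]
      have h4 := hd [b]
      simp only [List.sum_singleton, List.length_singleton] at h3 h4
      omega
  rw [e, h1] at h2
  exact_mod_cast (by omega : Q.natDegree < a + b)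

/-- The coefficient polynomials of the expansion: `ℓ k` is the coefficient of `h ^ (k - 2)` of the
variance polynomial at `g = γ`, `n = β h`. -/
theorem exists_expansion (γ : ℝ) (p : ℝ[X]) :
    ∃ ℓ : ℕ → ℝ[X], (∀ k, (ℓ k).natDegree ≤ k - 2) ∧ ∀ h β : ℝ,
      ∑ a ∈ Finset.range (p.natDegree + 1), ∑ b ∈ Finset.range (p.natDegree + 1),
        p.coeff a * p.coeff b * loopCov γ h (β * h) [a] [b] =
      ∑ k ∈ Finset.Icc 2 (2 * p.natDegree + 1), (ℓ k).eval β * h ^ (k - 2) := by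
  set m := p.natDegree
  set P : ℝ[X][X] := ∑ a ∈ Finset.range (m + 1), ∑ b ∈ Finset.range (m + 1),
    C (C (p.coeff a * p.coeff b)) * loopCov (C (C γ)) X (C X * X) [a] [b] with hP
  have hC : ∀ c : ℝ, (C (C c) : ℝ[X][X]) ∈ coeffDegreeSubring ℝ := by
    intro c k
    rw [coeff_C]; split_ifs <;> simp
  have hX : (X : ℝ[X][X]) ∈ coeffDegreeSubring ℝ := by
    intro k
    rw [coeff_X]; split_ifs <;> simp
  have hCX : (C X * X : ℝ[X][X]) ∈ coeffDegreeSubring ℝ := by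
    intro k
    rw [coeff_C_mul, coeff_X]; split_ifs with hk
    · simp [← hk]
    · simp
  have hmem : P ∈ coeffDegreeSubring ℝ :=
    sum_mem fun a _ => sum_mem fun b _ => mul_mem (hC _) (loopCov_mem _ (hC γ) hX hCX _ _)
  have hdeg : P.degree < (2 * m : ℕ) := by
    rw [← mem_degreeLT]
    refine sum_mem fun a ha => sum_mem fun b hb => ?_
    rw [mem_degreeLT]
    refine (degree_mul_le _ _).trans_lt ?_
    refine (add_le_add_left degree_C_le _).trans_lt ?_
    rw [zero_add]
    refine (degree_loopCov_lt γ a b).trans_le ?_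
    have := Finset.mem_range.1 ha
    have := Finset.mem_range.1 hb
    exact_mod_cast (by omega : a + b ≤ 2 * m)
  refine ⟨fun k => P.coeff (k - 2), fun k => hmem _, fun h β => ?_⟩
  let φ : ℝ[X][X] →+* ℝ := eval₂RingHom (evalRingHom β) h
  have h1 : φ P = ∑ a ∈ Finset.range (m + 1), ∑ b ∈ Finset.range (m + 1),
        p.coeff a * p.coeff b * loopCov γ h (β * h) [a] [b] := by
    simp only [hP, map_sum, map_mul, map_loopCov]
    simp [φ]
  have h2 : φ P = ∑ i ∈ Finset.range (2 * m), (P.coeff i).eval β * h ^ i := by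
    by_cases h0 : P = 0
    · simp [h0]
    simp only [φ, coe_eval₂RingHom]
    rw [eval₂_eq_sum_range' _ ((natDegree_lt_iff_degree_lt h0).2 hdeg)]
    simp
  rw [← h1, h2, Finset.range_eq_Ico]
  have h3 := Finset.sum_Ico_add' (fun k => (P.coeff (k - 2)).eval β * h ^ (k - 2)) 0 (2 * m) 2
  simp only [Nat.add_sub_cancel] at h3
  rw [h3, zero_add]
  exact Finset.sum_congr (by ext; simp; omega) fun _ _ => rfl

end Expansion

/-! ### Chebyshev polynomials diagonalize the limiting covariance -/

section ChebyshevDiagonalization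

open Polynomial

/-- The linear functional on polynomials whose moments solve the limiting loop equations; these are
the moments of the Marchenko--Pastur law of parameter `γ`. -/
noncomputable def limitMoment (γ : ℝ) : ℝ[X] →ₗ[ℝ] ℝ :=
  lsum fun k => LinearMap.id.smulRight (loopMoment γ 0 0 [k])

/-- The bilinear form on polynomials that gives the limiting covariance at `h = n = 0`. -/
noncomputable def limitCov (γ : ℝ) : ℝ[X] →ₗ[ℝ] ℝ[X] →ₗ[ℝ] ℝ :=
  lsum fun a => LinearMap.id.smulRight
    (lsum fun b => LinearMap.id.smulRight (loopCov γ 0 0 [a] [b]))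

/-- The operator `ψ ↦ ∫ (x ψ(x) - y ψ(y)) / (x - y) dm(y)` for the functional `m = limitMoment γ`, given
on monomials. -/
noncomputable def limitDivDiff (γ : ℝ) : ℝ[X] →ₗ[ℝ] ℝ[X] :=
  lsum fun k => LinearMap.id.smulRight
    (∑ l ∈ Finset.range (k + 1), C (loopMoment γ 0 0 [l]) * X ^ (k - l))

theorem limitMoment_X_pow (γ : ℝ) (k : ℕ) :
    limitMoment γ (X ^ k) = loopMoment γ 0 0 [k] := by
  simp [limitMoment, lsum_apply, ← monomial_one_right_eq_X_pow, sum_monomial_index]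

theorem limitCov_X_pow (γ : ℝ) (a b : ℕ) :
    limitCov γ (X ^ a) (X ^ b) = loopCov γ 0 0 [a] [b] := by
  simp [limitCov, lsum_apply, ← monomial_one_right_eq_X_pow, sum_monomial_index]

theorem limitDivDiff_X_pow (γ : ℝ) (k : ℕ) :
    limitDivDiff γ (X ^ k) =
      ∑ l ∈ Finset.range (k + 1), C (loopMoment γ 0 0 [l]) * X ^ (k - l) := by
  simp [limitDivDiff, lsum_apply, ← monomial_one_right_eq_X_pow, sum_monomial_index]

theorem eq_of_eq_on_X_pow {M : Type*} [AddCommMonoid M] [Module ℝ M] {f g : ℝ[X] →ₗ[ℝ] M}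
    (h : ∀ k : ℕ, f (X ^ k) = g (X ^ k)) : f = g := by
  refine lhom_ext' fun k => LinearMap.ext_ring ?_
  simpa [monomial_one_right_eq_X_pow] using h k

theorem limitDivDiff_X_mul (γ : ℝ) (ψ : ℝ[X]) :
    limitDivDiff γ (X * ψ) = X * limitDivDiff γ ψ + C (limitMoment γ (X * ψ)) := by
  have : limitDivDiff γ ∘ₗ LinearMap.mulLeft ℝ X =
      LinearMap.mulLeft ℝ X ∘ₗ limitDivDiff γ +
        (Algebra.linearMap ℝ ℝ[X]) ∘ₗ limitMoment γ ∘ₗ LinearMap.mulLeft ℝ X := by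
    refine eq_of_eq_on_X_pow fun k => ?_
    simp only [LinearMap.comp_apply, LinearMap.mulLeft_apply, LinearMap.add_apply, ← pow_succ',
      limitDivDiff_X_pow, limitMoment_X_pow, Algebra.linearMap_apply, algebraMap_eq]
    rw [Finset.sum_range_succ, Finset.mul_sum]
    congr 1
    · refine Finset.sum_congr rfl fun l hl => ?_
      have : l ≤ k := Nat.lt_succ_iff.1 (Finset.mem_range.1 hl)
      rw [show k + 1 - l = k - l + 1 by omega, pow_succ]
      ring
    · simp
  simpa [algebraMap_eq] using LinearMap.congr_fun this ψ

theorem limitMoment_X_mul (γ : ℝ) (ψ : ℝ[X]) :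
    limitMoment γ (X * ψ) = γ * limitMoment γ (limitDivDiff γ ψ) + (1 - γ) * limitMoment γ ψ := by
  have : limitMoment γ ∘ₗ LinearMap.mulLeft ℝ X =
      γ • (limitMoment γ ∘ₗ limitDivDiff γ) + (1 - γ) • limitMoment γ := by
    refine eq_of_eq_on_X_pow fun k => ?_
    simp only [LinearMap.comp_apply, LinearMap.mulLeft_apply, LinearMap.add_apply, ← pow_succ',
      limitDivDiff_X_pow, limitMoment_X_pow, LinearMap.smul_apply, map_sum, ← smul_eq_C_mul,
      map_smul, loopMoment_singleton_succ_leading, smul_eq_mul]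
  simpa using LinearMap.congr_fun this ψ

theorem limitCov_X_mul (γ : ℝ) (ψ q : ℝ[X]) :
    limitCov γ (X * ψ) q = 2 * γ * limitCov γ (limitDivDiff γ ψ) q + (1 - γ) * limitCov γ ψ q +
      2 * γ * limitMoment γ (X * ψ * derivative q) := by
  have key : ∀ k : ℕ, limitCov γ (X * X ^ k) = (2 * γ) • limitCov γ (limitDivDiff γ (X ^ k)) +
      (1 - γ) • limitCov γ (X ^ k) +
        (2 * γ) • (limitMoment γ ∘ₗ LinearMap.mulLeft ℝ (X * X ^ k) ∘ₗ derivative) := by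
    intro k
    refine eq_of_eq_on_X_pow fun j => ?_
    have hj : limitMoment γ (X ^ (k + 1) * derivative (X ^ j)) =
        j * loopMoment γ 0 0 [k + j] := by
      rcases j with _ | j
      · simp
      · rw [derivative_X_pow, mul_left_comm, ← smul_eq_C_mul, map_smul, ← pow_add,
          limitMoment_X_pow, smul_eq_mul]
        congr 3
        simp; omega
    simp only [LinearMap.comp_apply, LinearMap.mulLeft_apply, LinearMap.add_apply, ← pow_succ',
      limitDivDiff_X_pow, limitCov_X_pow, LinearMap.smul_apply, map_sum, ← smul_eq_C_mul,
      map_smul, loopCov_singleton_succ_leading, smul_eq_mul, hj, LinearMap.sum_apply]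
  have : (limitCov γ).flip q ∘ₗ LinearMap.mulLeft ℝ X =
      (2 * γ) • ((limitCov γ).flip q ∘ₗ limitDivDiff γ) + (1 - γ) • (limitCov γ).flip q +
        (2 * γ) • (limitMoment γ ∘ₗ LinearMap.mulRight ℝ (derivative q) ∘ₗ LinearMap.mulLeft ℝ X) := by
    refine eq_of_eq_on_X_pow fun k => ?_
    simpa [mul_assoc] using LinearMap.congr_fun (key k) q
  simpa using LinearMap.congr_fun this ψ

theorem limitCov_one (γ : ℝ) (q : ℝ[X]) : limitCov γ 1 q = 0 := by
  have : limitCov γ 1 = 0 := by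
    refine eq_of_eq_on_X_pow fun b => ?_
    rw [← pow_zero X, limitCov_X_pow, loopCov_singleton_zero, LinearMap.zero_apply]
  rw [this, LinearMap.zero_apply]

/-- The operator `Λ` with `limitCov γ (Λ ψ) q = 2γ m(x ψ q')`. -/
noncomputable def loopOperator (γ : ℝ) (ψ : ℝ[X]) : ℝ[X] :=
  X * ψ - (1 - γ) • ψ - (2 * γ) • limitDivDiff γ ψ

theorem limitCov_loopOperator (γ : ℝ) (ψ q : ℝ[X]) :
    limitCov γ (loopOperator γ ψ) q = 2 * γ * limitMoment γ (X * ψ * derivative q) := by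
  simp only [loopOperator, map_sub, map_smul, LinearMap.sub_apply, LinearMap.smul_apply,
    smul_eq_mul, limitCov_X_mul γ ψ]
  ring

theorem limitMoment_loopOperator (γ : ℝ) (ψ : ℝ[X]) :
    limitMoment γ (loopOperator γ ψ) = (1 - γ) * limitMoment γ ψ - limitMoment γ (X * ψ) := by
  simp only [loopOperator, map_sub, map_smul, smul_eq_mul]
  linear_combination 2 * limitMoment_X_mul γ ψ

/-- The coordinate `z = (x - (1 + γ)) / (2√γ)`, which maps `[(1 - √γ)², (1 + √γ)²]` to `[-1, 1]`. -/
noncomputable def marchenkoPasturCoord (γ : ℝ) : ℝ[X] := C (1 / (2 * √γ)) * (X - C (1 + γ))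

/-- The Chebyshev polynomial `T_k` in the coordinate `z`. -/
noncomputable def shiftedT (γ : ℝ) (k : ℤ) : ℝ[X] := (Chebyshev.T ℝ k).comp (marchenkoPasturCoord γ)

/-- The Chebyshev polynomial `U_k` in the coordinate `z`. -/
noncomputable def shiftedU (γ : ℝ) (k : ℤ) : ℝ[X] := (Chebyshev.U ℝ k).comp (marchenkoPasturCoord γ)

theorem X_eq_marchenkoPasturCoord {γ : ℝ} (hγ : 0 < γ) :
    (X : ℝ[X]) = (2 * √γ) • marchenkoPasturCoord γ + (1 + γ) • 1 := by
  have : √γ ≠ 0 := (Real.sqrt_pos.2 hγ).ne'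
  rw [marchenkoPasturCoord, smul_eq_C_mul, ← mul_assoc, ← C_mul, mul_one_div_cancel (by positivity),
    smul_eq_C_mul]
  simp

theorem shiftedT_add_two (γ : ℝ) (k : ℤ) :
    shiftedT γ (k + 2) = 2 * marchenkoPasturCoord γ * shiftedT γ (k + 1) - shiftedT γ k := by
  simp [shiftedT, Chebyshev.T_add_two]

theorem shiftedU_add_two (γ : ℝ) (k : ℤ) :
    shiftedU γ (k + 2) = 2 * marchenkoPasturCoord γ * shiftedU γ (k + 1) - shiftedU γ k := by
  simp [shiftedU, Chebyshev.U_add_two]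

theorem derivative_shiftedT (γ : ℝ) (k : ℤ) :
    derivative (shiftedT γ k) = (k / (2 * √γ)) • shiftedU γ (k - 1) := by
  rw [shiftedT, derivative_comp, Chebyshev.T_derivative_eq_U, shiftedU, marchenkoPasturCoord]
  simp only [derivative_mul, derivative_C, derivative_sub, derivative_X, smul_eq_C_mul, zero_mul,
    mul_comp, intCast_comp, div_eq_mul_one_div (k : ℝ), C_mul]
  simp
  ring

theorem loopOperator_shiftedU_succ {γ : ℝ} (hγ : 0 < γ) (k : ℤ) :
    loopOperator γ (shiftedU γ (k + 2)) = 2 * marchenkoPasturCoord γ * loopOperator γ (shiftedU γ (k + 1)) -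
      loopOperator γ (shiftedU γ k) -
        C (2 * √γ * limitMoment γ (X * shiftedU γ (k + 1))) := by
  have hs : √γ ≠ 0 := (Real.sqrt_pos.2 hγ).ne'
  have hs2 : √γ * √γ = γ := Real.mul_self_sqrt hγ.le
  have hZ : ∀ ψ : ℝ[X], 2 * marchenkoPasturCoord γ * ψ =
      (1 / √γ) • (X * ψ) - ((1 + γ) / √γ) • ψ := by
    intro ψ
    rw [marchenkoPasturCoord]
    have : (2 : ℝ[X]) * C (1 / (2 * √γ)) = C (1 / √γ) := by
      rw [← C_ofNat, ← C_mul]; congr 1; field_simp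
    have h2 : C ((1 + γ) / √γ) = C (1 / √γ) * C (1 + γ) := by
      rw [← C_mul]; congr 1; field_simp
    rw [← mul_assoc, this, smul_eq_C_mul, smul_eq_C_mul, h2]
    ring
  have hB : limitDivDiff γ (2 * marchenkoPasturCoord γ * shiftedU γ (k + 1)) =
      2 * marchenkoPasturCoord γ * limitDivDiff γ (shiftedU γ (k + 1)) +
        C (1 / √γ * limitMoment γ (X * shiftedU γ (k + 1))) := by
    rw [hZ, hZ, map_sub, map_smul, map_smul, limitDivDiff_X_mul, C_mul]
    simp only [smul_eq_C_mul]
    ring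
  have hc : C (2 * √γ * limitMoment γ (X * shiftedU γ (k + 1))) =
      C (2 * γ) * C (1 / √γ * limitMoment γ (X * shiftedU γ (k + 1))) := by
    rw [← C_mul]; congr 1; field_simp; linear_combination (limitMoment γ (X * shiftedU γ (k + 1))) * hs2
  rw [shiftedU_add_two, loopOperator, map_sub, hB, loopOperator, loopOperator, hc]
  simp only [smul_eq_C_mul]
  ring

theorem two_smul_shiftedT (γ : ℝ) (k : ℤ) :
    (2 : ℝ) • shiftedT γ (k + 1) = shiftedU γ (k + 1) - shiftedU γ (k - 1) := by
  have := congrArg (fun q => q.comp (marchenkoPasturCoord γ)) (Chebyshev.two_mul_T_eq_U_sub_U ℝ (k - 1))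
  rw [show k - 1 + 2 = k + 1 by ring] at this
  simp only [mul_comp, sub_comp, ofNat_comp] at this
  rw [smul_eq_C_mul, C_ofNat]
  exact this

theorem X_mul_shiftedU {γ : ℝ} (hγ : 0 < γ) (k : ℤ) :
    X * shiftedU γ k =
      √γ • shiftedU γ (k + 1) + √γ • shiftedU γ (k - 1) + (1 + γ) • shiftedU γ k := by
  have h := shiftedU_add_two γ (k - 1)
  rw [show k - 1 + 2 = k + 1 by ring, sub_add_cancel] at h
  rw [X_eq_marchenkoPasturCoord hγ, h]
  simp only [smul_eq_C_mul, C_mul, C_ofNat]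
  ring

theorem shiftedU_zero (γ : ℝ) : shiftedU γ 0 = 1 := by simp [shiftedU]

theorem shiftedU_neg_one (γ : ℝ) : shiftedU γ (-1) = 0 := by simp [shiftedU]

theorem shiftedT_zero (γ : ℝ) : shiftedT γ 0 = 1 := by simp [shiftedT]

theorem shiftedT_one (γ : ℝ) : shiftedT γ 1 = marchenkoPasturCoord γ := by simp [shiftedT]

theorem limitMoment_one (γ : ℝ) : limitMoment γ 1 = 1 := by
  rw [← pow_zero X, limitMoment_X_pow, loopMoment_singleton_zero]

/-- Expand `m(x U_k)` by the three-term recurrence and by `limitMoment_loopOperator`, and compare. -/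
theorem limitMoment_shiftedU_of_loopOperator {γ : ℝ} (hγ : 0 < γ) {k : ℤ}
    (hk : loopOperator γ (shiftedU γ k) = (2 * √γ) • shiftedT γ (k + 1)) :
    limitMoment γ (X * shiftedU γ k) =
        limitMoment γ (shiftedU γ k) + √γ * limitMoment γ (shiftedU γ (k - 1)) ∧
      limitMoment γ (shiftedU γ (k + 1)) = -√γ * limitMoment γ (shiftedU γ k) := by
  have hs : √γ ≠ 0 := (Real.sqrt_pos.2 hγ).ne'
  have hs2 : √γ * √γ = γ := Real.mul_self_sqrt hγ.le
  have h1 := limitMoment_loopOperator γ (shiftedU γ k)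
  rw [hk, mul_comm 2, mul_smul, two_smul_shiftedT] at h1
  have h2 := congrArg (limitMoment γ) (X_mul_shiftedU hγ k)
  simp only [map_smul, map_sub, map_add, smul_eq_mul] at h1 h2
  constructor
  · linear_combination (h1 + h2) / 2
  · refine mul_left_cancel₀ hs ?_
    linear_combination (h1 - h2) / 2 + limitMoment γ (shiftedU γ k) * hs2

/-- `Λ U_k = 2√γ T_{k+1}`. The induction carries two consecutive indices; the step needs
`m(x U_{k+1}) = 0`, which follows from the case `k` by `limitMoment_shiftedU_of_loopOperator`. -/
theorem loopOperator_shiftedU {γ : ℝ} (hγ : 0 < γ) (k : ℕ) :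
    loopOperator γ (shiftedU γ k) = (2 * √γ) • shiftedT γ (k + 1) ∧
      loopOperator γ (shiftedU γ (k + 1)) = (2 * √γ) • shiftedT γ (k + 2) := by
  induction k with
  | zero =>
    have hB : limitDivDiff γ 1 = 1 := by
      rw [← pow_zero X, limitDivDiff_X_pow]; simp [loopMoment_singleton_zero]
    have h0 : loopOperator γ (shiftedU γ 0) = (2 * √γ) • shiftedT γ (0 + 1) := by
      rw [shiftedU_zero, loopOperator, hB, zero_add, shiftedT_one, mul_one]
      nth_rewrite 1 [X_eq_marchenkoPasturCoord hγ]
      module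
    refine ⟨by simpa using h0, ?_⟩
    have h1 := (limitMoment_shiftedU_of_loopOperator hγ h0).1
    rw [zero_sub, shiftedU_neg_one, shiftedU_zero, map_zero, limitMoment_one] at h1
    have h2 := loopOperator_shiftedU_succ hγ (-1)
    have h3 := shiftedT_add_two γ 0
    have h4 : loopOperator γ 0 = 0 := by simp [loopOperator]
    rw [show (-1 : ℤ) + 2 = 0 + 1 by norm_num, show (-1 : ℤ) + 1 = 0 by norm_num, h0,
      shiftedU_neg_one, h4, shiftedU_zero, h1] at h2
    rw [Nat.cast_zero, h2, h3, shiftedT_zero, zero_add, shiftedT_one]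
    simp only [smul_eq_C_mul, mul_zero, add_zero, mul_one, sub_zero]
    ring
  | succ k ih =>
    obtain ⟨ih1, ih2⟩ := ih
    have h1 := (limitMoment_shiftedU_of_loopOperator hγ ih1).2
    have ih2' : loopOperator γ (shiftedU γ (k + 1)) = (2 * √γ) • shiftedT γ (k + 1 + 1) := by
      rw [ih2, add_assoc]; rfl
    have h2 := (limitMoment_shiftedU_of_loopOperator hγ ih2').1
    rw [add_sub_cancel_right, h1, neg_mul, neg_add_cancel] at h2
    have h3 := loopOperator_shiftedU_succ hγ k
    have h4 := shiftedT_add_two γ (k + 1)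
    rw [h2, ih1, ih2'] at h3
    push_cast
    refine ⟨ih2', ?_⟩
    rw [show (k : ℤ) + 1 + 1 = k + 2 by ring, h3, h4]
    simp only [smul_eq_C_mul, mul_zero, C_0, sub_zero]
    ring

theorem limitMoment_X_mul_shiftedU {γ : ℝ} (hγ : 0 < γ) {k : ℤ} (hk : -1 ≤ k) :
    limitMoment γ (X * shiftedU γ k) = if k = 0 then 1 else 0 := by
  obtain ⟨j, rfl⟩ : ∃ j : ℕ, k = j - 1 := ⟨(k + 1).toNat, by omega⟩
  rcases j with _ | _ | j
  · simp [shiftedU_neg_one]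
  · have h := (limitMoment_shiftedU_of_loopOperator hγ (loopOperator_shiftedU hγ 0).1).1
    simp only [Nat.cast_zero, zero_sub, shiftedU_neg_one, shiftedU_zero, map_zero,
      limitMoment_one] at h
    simpa [shiftedU_zero] using h
  · have h1 := (limitMoment_shiftedU_of_loopOperator hγ (loopOperator_shiftedU hγ j).1).2
    have h2 := (limitMoment_shiftedU_of_loopOperator hγ (loopOperator_shiftedU hγ (j + 1)).1).1
    push_cast at h2 ⊢
    rw [add_sub_cancel_right, h1, neg_mul, neg_add_cancel] at h2
    rw [add_sub_cancel_right, h2, if_neg (by omega)]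

/-- The `U_k(z)` are orthonormal for the functional `q ↦ m(x q)`, a semicircle law. -/
theorem limitMoment_X_mul_shiftedU_mul_shiftedU {γ : ℝ} (hγ : 0 < γ) (b : ℕ) :
    ∀ a : ℤ, -1 ≤ a →
      limitMoment γ (X * (shiftedU γ a * shiftedU γ b)) = if a = b then 1 else 0 := by
  have two_mul : ∀ c : ℤ, 2 * marchenkoPasturCoord γ * shiftedU γ c =
      shiftedU γ (c + 1) + shiftedU γ (c - 1) := by
    intro c
    have h := shiftedU_add_two γ (c - 1)
    rw [show c - 1 + 2 = c + 1 by ring, sub_add_cancel] at h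
    rw [h]; ring
  suffices h : ∀ b : ℕ, (∀ a : ℤ, -1 ≤ a →
      limitMoment γ (X * (shiftedU γ a * shiftedU γ b)) = if a = b then 1 else 0) ∧
      (∀ a : ℤ, -1 ≤ a →
      limitMoment γ (X * (shiftedU γ a * shiftedU γ (b + 1))) = if a = b + 1 then 1 else 0) from
    (h b).1
  have step : ∀ (b : ℤ) (a : ℤ), limitMoment γ (X * (shiftedU γ a * shiftedU γ (b + 1))) =
      limitMoment γ (X * (shiftedU γ (a + 1) * shiftedU γ b)) +
      limitMoment γ (X * (shiftedU γ (a - 1) * shiftedU γ b)) -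
      limitMoment γ (X * (shiftedU γ a * shiftedU γ (b - 1))) := by
    intro b a
    rw [← map_add, ← map_sub]
    congr 1
    linear_combination X * shiftedU γ b * two_mul a - X * shiftedU γ a * two_mul b
  intro b
  induction b with
  | zero =>
    have h0 : ∀ a : ℤ, -1 ≤ a →
        limitMoment γ (X * (shiftedU γ a * shiftedU γ 0)) = if a = 0 then 1 else 0 := by
      intro a ha
      rw [shiftedU_zero, mul_one, limitMoment_X_mul_shiftedU hγ ha]
    refine ⟨h0, fun a ha => ?_⟩
    rw [Nat.cast_zero, step, zero_sub, shiftedU_neg_one, mul_zero, mul_zero, map_zero, sub_zero]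
    rcases eq_or_lt_of_le ha with rfl | ha
    · simpa [shiftedU_neg_one] using (step 0 (-1)).symm
    rw [h0 _ (by omega), h0 _ (by omega)]
    split_ifs <;> first | omega | simp
  | succ b ih =>
    push_cast
    refine ⟨ih.2, fun a ha => ?_⟩
    rcases eq_or_lt_of_le ha with rfl | ha
    · rw [shiftedU_neg_one, zero_mul, mul_zero, map_zero, if_neg (by omega)]
    rw [step, add_sub_cancel_right, ih.1 _ ha.le, ih.2 _ (by omega), ih.2 _ (by omega)]
    split_ifs <;> first | omega | simp

/-- Apply `limitCov_loopOperator` to `ψ = U_a(z)` and `q = T_b(z)`. -/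
theorem limitCov_shiftedT {γ : ℝ} (hγ : 0 < γ) (a b : ℕ) :
    limitCov γ (shiftedT γ a) (shiftedT γ b) = if a = b then (a : ℝ) / 2 else 0 := by
  have hs : √γ ≠ 0 := (Real.sqrt_pos.2 hγ).ne'
  have hs2 : √γ * √γ = γ := Real.mul_self_sqrt hγ.le
  rcases a with _ | a
  · simp [shiftedT_zero, limitCov_one]
  have h := limitCov_loopOperator γ (shiftedU γ a) (shiftedT γ b)
  rw [(loopOperator_shiftedU hγ a).1, derivative_shiftedT, mul_smul_comm, mul_assoc X, map_smul,
    map_smul, LinearMap.smul_apply, smul_eq_mul, smul_eq_mul] at h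
  push_cast at h ⊢
  rcases b with _ | b
  · simp only [Nat.cast_zero, zero_div, zero_mul, mul_zero, mul_eq_zero] at h
    rw [if_neg (by omega)]
    simpa [hs] using h
  rw [Nat.cast_succ, add_sub_cancel_right, limitMoment_X_mul_shiftedU_mul_shiftedU hγ b a (by omega)] at h
  have h2 : limitCov γ (shiftedT γ (a + 1)) (shiftedT γ (b + 1)) =
      (b + 1) / 2 * if (a : ℤ) = b then 1 else 0 := by
    refine mul_left_cancel₀ (mul_ne_zero two_ne_zero hs) ?_
    push_cast at h
    rw [h]
    field_simp
    linear_combination (- if (a : ℤ) = b then (1 : ℝ) else 0) * hs2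
  push_cast
  rw [h2]
  by_cases hab : a = b
  · subst hab; simp
  · rw [if_neg (by exact_mod_cast hab), if_neg (by omega), mul_zero]

theorem exists_eq_sum_shiftedT {γ : ℝ} (hγ : 0 < γ) (p : ℝ[X]) :
    ∃ c : ℕ →₀ ℝ, p = c.sum fun k a => a • shiftedT γ k := by
  have hmem : ∀ k : ℕ, shiftedT γ k ∈ Submodule.span ℝ (Set.range fun k : ℕ => shiftedT γ k) :=
    fun k => Submodule.subset_span ⟨k, rfl⟩
  suffices h : p ∈ Submodule.span ℝ (Set.range fun k : ℕ => shiftedT γ k) by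
    obtain ⟨c, hc⟩ := Finsupp.mem_span_range_iff_exists_finsupp.1 h
    exact ⟨c, hc.symm⟩
  have hX : ∀ q ∈ Submodule.span ℝ (Set.range fun k : ℕ => shiftedT γ k),
      X * q ∈ Submodule.span ℝ (Set.range fun k : ℕ => shiftedT γ k) := by
    intro q hq
    induction hq using Submodule.span_induction with
    | mem q hq =>
      obtain ⟨k, rfl⟩ := hq
      have h1 : X * shiftedT γ k = √γ • (2 * marchenkoPasturCoord γ * shiftedT γ k) +
          (1 + γ) • shiftedT γ k := by
        nth_rewrite 1 [X_eq_marchenkoPasturCoord hγ]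
        simp only [smul_eq_C_mul, C_mul, C_ofNat]
        ring
      rw [h1]
      refine add_mem (Submodule.smul_mem _ _ ?_) (Submodule.smul_mem _ _ (hmem k))
      rcases k with _ | k
      · have : 2 * marchenkoPasturCoord γ * shiftedT γ (0 : ℕ) = (2 : ℝ) • shiftedT γ (1 : ℕ) := by
          simp [shiftedT_zero, shiftedT_one, smul_eq_C_mul, C_ofNat]
        rw [this]
        exact Submodule.smul_mem _ _ (hmem 1)
      · have : 2 * marchenkoPasturCoord γ * shiftedT γ (k + 1 : ℕ) =
            shiftedT γ (k + 2 : ℕ) + shiftedT γ k := by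
          push_cast
          rw [shiftedT_add_two]; ring
        rw [this]
        exact add_mem (hmem _) (hmem _)
    | zero => simp
    | add q r _ _ hq hr => rw [mul_add]; exact add_mem hq hr
    | smul a q _ hq => rw [mul_smul_comm]; exact Submodule.smul_mem _ _ hq
  have hpow : ∀ k : ℕ, (X : ℝ[X]) ^ k ∈
      Submodule.span ℝ (Set.range fun k : ℕ => shiftedT γ k) := by
    intro k
    induction k with
    | zero => simpa [shiftedT_zero] using hmem 0
    | succ k ih => rw [pow_succ']; exact hX _ ih
  rw [p.as_sum_range_C_mul_X_pow]
  refine sum_mem fun k _ => ?_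
  rw [← smul_eq_C_mul]
  exact Submodule.smul_mem _ _ (hpow k)

theorem limitCov_sum_shiftedT {γ : ℝ} (hγ : 0 < γ) (c : ℕ →₀ ℝ) :
    limitCov γ (c.sum fun k a => a • shiftedT γ k) (c.sum fun k a => a • shiftedT γ k) =
      1 / 2 * ∑ k ∈ c.support, k * c k ^ 2 := by
  simp only [Finsupp.sum, map_sum, map_smul, LinearMap.sum_apply, LinearMap.smul_apply,
    limitCov_shiftedT hγ, smul_eq_mul, Finset.mul_sum]
  refine Finset.sum_congr rfl fun k hk => ?_
  rw [Finset.sum_eq_single_of_mem k hk]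
  · simp; ring
  · intro j _ hj
    simp [hj]

theorem limitCov_eq_sum_coeff (γ : ℝ) (p : ℝ[X]) :
    limitCov γ p p = ∑ a ∈ Finset.range (p.natDegree + 1), ∑ b ∈ Finset.range (p.natDegree + 1),
      p.coeff a * p.coeff b * loopCov γ 0 0 [a] [b] := by
  nth_rewrite 1 2 [p.as_sum_range_C_mul_X_pow]
  simp only [← smul_eq_C_mul, map_sum, map_smul, LinearMap.sum_apply, LinearMap.smul_apply,
    limitCov_X_pow, smul_eq_mul, Finset.mul_sum]
  rw [Finset.sum_comm]
  refine Finset.sum_congr rfl fun a _ => Finset.sum_congr rfl fun b _ => ?_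
  ring

end ChebyshevDiagonalization

/-! ### The double integral in Chebyshev coordinates -/

section LimitingVarianceIntegral

open Real Set

theorem integral_cos_natCast_mul (n : ℕ) :
    ∫ t in (0 : ℝ)..π, cos (n * t) = if n = 0 then π else 0 := by
  split_ifs with h
  · simp [h]
  · have : (n : ℝ) ≠ 0 := Nat.cast_ne_zero.2 h
    rw [intervalIntegral.integral_comp_mul_left _ this]
    simp [Real.sin_nat_mul_pi]

theorem integral_cos_mul_cos (i j : ℕ) :
    ∫ t in (0 : ℝ)..π, cos (i * t) * cos (j * t) =
      if i = j then (if j = 0 then π else π / 2) else 0 := by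
  wlog hij : j ≤ i generalizing i j
  · simp_rw [mul_comm (cos (i * _))]
    rw [this j i (by omega)]
    split_ifs <;> first | omega | rfl
  have h : ∀ t : ℝ, cos (i * t) * cos (j * t) =
      1 / 2 * cos ((i + j : ℕ) * t) + 1 / 2 * cos ((i - j : ℕ) * t) := by
    intro t
    push_cast [hij]
    rw [add_mul, sub_mul, cos_add, cos_sub]
    ring
  simp_rw [h]
  rw [intervalIntegral.integral_add (by apply Continuous.intervalIntegrable; fun_prop)
    (by apply Continuous.intervalIntegrable; fun_prop), intervalIntegral.integral_const_mul,
    intervalIntegral.integral_const_mul, integral_cos_natCast_mul, integral_cos_natCast_mul]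
  split_ifs <;> first | omega | ring

theorem integral_sin_mul_sin {i j : ℕ} (hi : i ≠ 0) :
    ∫ t in (0 : ℝ)..π, sin (i * t) * sin (j * t) = if i = j then π / 2 else 0 := by
  have h : ∀ t : ℝ, sin (i * t) * sin (j * t) =
      cos ((i : ℤ) * t - (j : ℤ) * t) - cos (i * t) * cos (j * t) := by
    intro t
    push_cast
    rw [cos_sub]
    ring
  have h2 : ∫ t in (0 : ℝ)..π, cos ((i : ℤ) * t - (j : ℤ) * t) = if i = j then π else 0 := by
    have := integral_cos_natCast_mul (i - j : ℤ).natAbs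
    have h3 : ∀ t : ℝ, cos ((i : ℤ) * t - (j : ℤ) * t) = cos (((i - j : ℤ).natAbs : ℝ) * t) := by
      intro t
      rw [← cos_abs, ← cos_abs ((Int.natAbs _ : ℝ) * t), abs_mul, Nat.cast_natAbs, ← sub_mul, abs_mul]
      push_cast
      rw [abs_abs]
    simp_rw [h3, this]
    split_ifs <;> first | omega | rfl
  simp_rw [h]
  rw [intervalIntegral.integral_sub (by apply Continuous.intervalIntegrable; fun_prop)
    (by apply Continuous.intervalIntegrable; fun_prop), h2, integral_cos_mul_cos]
  split_ifs <;> first | omega | ring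

theorem integral_integral_sum_mul_sq {ι : Type*} (s : Finset ι) (f g : ι → ℝ → ℝ)
    (hf : ∀ i, Continuous (f i)) (hg : ∀ i, Continuous (g i)) (a b : ℝ) :
    ∫ x in a..b, ∫ y in a..b, (∑ i ∈ s, f i x * g i y) ^ 2 =
      ∑ i ∈ s, ∑ j ∈ s, (∫ x in a..b, f i x * f j x) * ∫ y in a..b, g i y * g j y := by
  have h : ∀ x y, (∑ i ∈ s, f i x * g i y) ^ 2 =
      ∑ i ∈ s, ∑ j ∈ s, (f i x * f j x) * (g i y * g j y) := by
    intro x y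
    rw [sq, Finset.sum_mul_sum]
    exact Finset.sum_congr rfl fun i _ => Finset.sum_congr rfl fun j _ => by ring
  have hy : ∀ x, ∫ y in a..b, (∑ i ∈ s, f i x * g i y) ^ 2 =
      ∑ i ∈ s, ∑ j ∈ s, (f i x * f j x) * ∫ y in a..b, g i y * g j y := by
    intro x
    simp_rw [h]
    rw [intervalIntegral.integral_finsetSum fun i _ => by
      apply Continuous.intervalIntegrable; fun_prop]
    refine Finset.sum_congr rfl fun i _ => ?_
    rw [intervalIntegral.integral_finsetSum fun j _ => by
      apply Continuous.intervalIntegrable; fun_prop]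
    exact Finset.sum_congr rfl fun j _ => intervalIntegral.integral_const_mul _ _
  simp_rw [hy]
  rw [intervalIntegral.integral_finsetSum fun i _ => by
    apply Continuous.intervalIntegrable; fun_prop]
  refine Finset.sum_congr rfl fun i _ => ?_
  rw [intervalIntegral.integral_finsetSum fun j _ => by
    apply Continuous.intervalIntegrable; fun_prop]
  exact Finset.sum_congr rfl fun j _ => intervalIntegral.integral_mul_const _ _

/-- The coefficients `1, 2, 2, …` of a cosine expansion. -/
noncomputable def cosineWeight (j : ℕ) : ℝ := if j = 0 then 1 else 2

/-- The Fourier expansion of `sin θ (cos aθ - cos aφ) / (cos θ - cos φ)`, see `cos_sub_cos_mul_sin`. -/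
noncomputable def cosDivDiff (a : ℕ) (θ φ : ℝ) : ℝ :=
  ∑ j ∈ Finset.range a, cosineWeight j * sin ((a - j : ℕ) * θ) * cos (j * φ)

theorem cosDivDiff_add_two (a : ℕ) (θ φ : ℝ) :
    cosDivDiff (a + 2) θ φ =
      2 * cos θ * cosDivDiff (a + 1) θ φ - cosDivDiff a θ φ + 2 * cos ((a + 1 : ℕ) * φ) * sin θ := by
  have h1 : ∀ k : ℕ, sin ((k + 2 : ℕ) * θ) = 2 * cos θ * sin ((k + 1 : ℕ) * θ) - sin (k * θ) := by
    intro k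
    have e1 : ((k + 2 : ℕ) : ℝ) * θ = (k + 1 : ℕ) * θ + θ := by push_cast; ring
    have e2 : (k : ℝ) * θ = (k + 1 : ℕ) * θ - θ := by push_cast; ring
    rw [e1, e2, sin_add, sin_sub]; ring
  have h2 : ∀ j ∈ Finset.range a, cosineWeight j * sin ((a + 2 - j : ℕ) * θ) * cos (j * φ) =
      2 * cos θ * (cosineWeight j * sin ((a + 1 - j : ℕ) * θ) * cos (j * φ)) -
        cosineWeight j * sin ((a - j : ℕ) * θ) * cos (j * φ) := by
    intro j hj
    have := Finset.mem_range.1 hj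
    have := h1 (a - j)
    rw [show a + 2 - j = a - j + 2 by omega, show a + 1 - j = a - j + 1 by omega, this]
    ring
  have h3 := h1 0
  simp only [cosDivDiff]
  rw [Finset.sum_range_succ, Finset.sum_range_succ, Finset.sum_congr rfl h2,
    Finset.sum_sub_distrib, ← Finset.mul_sum, Finset.sum_range_succ]
  rw [show a + 2 - a = 0 + 2 by omega, show a + 2 - (a + 1) = 0 + 1 by omega,
    show a + 1 - a = 0 + 1 by omega, h3]
  have h4 : cosineWeight (a + 1) = 2 := by simp [cosineWeight]
  rw [h4]
  simp
  ring

theorem cos_sub_cos_mul_sin (a : ℕ) (θ φ : ℝ) :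
    (cos (a * θ) - cos (a * φ)) * sin θ = (cos θ - cos φ) * cosDivDiff a θ φ := by
  have h1 : ∀ (k : ℕ) (t : ℝ), cos ((k + 2 : ℕ) * t) = 2 * cos t * cos ((k + 1 : ℕ) * t) - cos (k * t) := by
    intro k t
    have e1 : ((k + 2 : ℕ) : ℝ) * t = (k + 1 : ℕ) * t + t := by push_cast; ring
    have e2 : (k : ℝ) * t = (k + 1 : ℕ) * t - t := by push_cast; ring
    rw [e1, e2, cos_add, cos_sub]; ring
  induction a using Nat.twoStepInduction with
  | zero => simp [cosDivDiff]
  | one => simp [cosDivDiff, cosineWeight]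
  | more a ih1 ih2 =>
    rw [cosDivDiff_add_two, h1 a θ, h1 a φ]
    linear_combination 2 * cos θ * ih2 - ih1

theorem integral_integral_cosDivDiff_sq (s : Finset ℕ) (c : ℕ → ℝ) :
    (∫ θ in (0 : ℝ)..π, ∫ φ in (0 : ℝ)..π, (∑ a ∈ s, c a * cosDivDiff a θ φ) ^ 2 =
      π ^ 2 * ∑ a ∈ s, if a = 0 then 0 else (a - 1 / 2) * c a ^ 2) ∧
    (∫ θ in (0 : ℝ)..π, ∫ φ in (0 : ℝ)..π, (∑ a ∈ s, c a * cosDivDiff a φ θ) ^ 2 =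
      π ^ 2 * ∑ a ∈ s, if a = 0 then 0 else (a - 1 / 2) * c a ^ 2) := by
  set I : Finset (Σ _ : ℕ, ℕ) := s.sigma fun a => Finset.range a
  let f : (Σ _ : ℕ, ℕ) → ℝ → ℝ := fun i t => c i.1 * cosineWeight i.2 * sin ((i.1 - i.2 : ℕ) * t)
  let g : (Σ _ : ℕ, ℕ) → ℝ → ℝ := fun i t => cos (i.2 * t)
  have hf : ∀ i, Continuous (f i) := fun i => by fun_prop
  have hg : ∀ i, Continuous (g i) := fun i => by fun_prop
  have hfg : ∀ θ φ, ∑ a ∈ s, c a * cosDivDiff a θ φ = ∑ i ∈ I, f i θ * g i φ := by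
    intro θ φ
    rw [Finset.sum_sigma]
    refine Finset.sum_congr rfl fun a _ => ?_
    rw [cosDivDiff, Finset.mul_sum]
    exact Finset.sum_congr rfl fun j _ => by ring
  have hfg' : ∀ θ φ, ∑ a ∈ s, c a * cosDivDiff a φ θ = ∑ i ∈ I, g i θ * f i φ := by
    intro θ φ
    rw [hfg]
    exact Finset.sum_congr rfl fun j _ => by ring
  have main : ∑ i ∈ I, ∑ j ∈ I, (∫ x in (0 : ℝ)..π, f i x * f j x) * ∫ y in (0 : ℝ)..π, g i y * g j y =
      π ^ 2 * ∑ a ∈ s, if a = 0 then 0 else (a - 1 / 2) * c a ^ 2 := by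
    have h1 : ∀ i ∈ I, ∑ j ∈ I, (∫ x in (0 : ℝ)..π, f i x * f j x) *
        ∫ y in (0 : ℝ)..π, g i y * g j y =
        c i.1 ^ 2 * (if i.2 = 0 then π ^ 2 / 2 else π ^ 2) := by
      intro i hi
      have hi2 : i.2 < i.1 := Finset.mem_range.1 (Finset.mem_sigma.1 hi).2
      have h2 : ∀ j : (Σ _ : ℕ, ℕ), ∫ x in (0 : ℝ)..π, f i x * f j x =
          c i.1 * cosineWeight i.2 * (c j.1 * cosineWeight j.2) *
            if i.1 - i.2 = j.1 - j.2 then π / 2 else 0 := by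
        intro j
        rw [← integral_sin_mul_sin (by omega), ← intervalIntegral.integral_const_mul]
        exact intervalIntegral.integral_congr fun t _ => by simp only [f]; ring
      rw [Finset.sum_eq_single_of_mem i hi]
      · rw [h2, integral_cos_mul_cos]
        simp only [cosineWeight, if_true]
        split_ifs <;> ring
      · intro j hj hji
        have hj2 : j.2 < j.1 := Finset.mem_range.1 (Finset.mem_sigma.1 hj).2
        rw [h2, integral_cos_mul_cos]
        by_cases e1 : i.1 - i.2 = j.1 - j.2
        · by_cases e2 : i.2 = j.2
          · have e3 : j.1 = i.1 := by omega
            exact absurd (Sigma.ext e3 (heq_of_eq e2.symm)) hji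
          · simp [e2]
        · simp [e1]
    rw [Finset.sum_congr rfl h1, Finset.sum_sigma, Finset.mul_sum]
    refine Finset.sum_congr rfl fun a _ => ?_
    change ∑ j ∈ Finset.range a, c a ^ 2 * (if j = 0 then π ^ 2 / 2 else π ^ 2) = _
    rw [← Finset.mul_sum]
    rcases a with _ | a
    · simp
    · rw [Finset.sum_range_succ']
      simp
      ring
  constructor
  · simp_rw [hfg]
    rw [integral_integral_sum_mul_sq I f g hf hg, main]
  · simp_rw [hfg']
    rw [integral_integral_sum_mul_sq I g f hg hf, ← main]
    exact Finset.sum_congr rfl fun i _ => Finset.sum_congr rfl fun j _ => mul_comm _ _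

theorem integral_integral_sub_sq (s : Finset ℕ) (c : ℕ → ℝ) :
    ∫ θ in (0 : ℝ)..π, ∫ φ in (0 : ℝ)..π,
      (∑ a ∈ s, c a * cos (a * θ) - ∑ a ∈ s, c a * cos (a * φ)) ^ 2 =
      π ^ 2 * ∑ a ∈ s, if a = 0 then 0 else c a ^ 2 := by
  let P : ℝ → ℝ := fun t => ∑ a ∈ s, c a * cos (a * t)
  have hP : Continuous P := by fun_prop
  have h1 : ∫ t in (0 : ℝ)..π, P t = ∑ a ∈ s, if a = 0 then c a * π else 0 := by
    rw [intervalIntegral.integral_finsetSum fun i _ => by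
      apply Continuous.intervalIntegrable; fun_prop]
    refine Finset.sum_congr rfl fun a _ => ?_
    rw [intervalIntegral.integral_const_mul, integral_cos_natCast_mul]
    split_ifs <;> simp
  have h2 : ∫ t in (0 : ℝ)..π, P t ^ 2 = ∑ a ∈ s, c a ^ 2 * if a = 0 then π else π / 2 := by
    have : ∀ t, P t ^ 2 = ∑ a ∈ s, ∑ b ∈ s, (c a * c b) * (cos (a * t) * cos (b * t)) := by
      intro t
      rw [sq, Finset.sum_mul_sum]
      exact Finset.sum_congr rfl fun i _ => Finset.sum_congr rfl fun j _ => by ring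
    simp_rw [this]
    rw [intervalIntegral.integral_finsetSum fun i _ => by
      apply Continuous.intervalIntegrable; fun_prop]
    refine Finset.sum_congr rfl fun a ha => ?_
    rw [intervalIntegral.integral_finsetSum fun i _ => by
      apply Continuous.intervalIntegrable; fun_prop]
    simp_rw [intervalIntegral.integral_const_mul, integral_cos_mul_cos]
    rw [Finset.sum_eq_single_of_mem a ha]
    · simp [sq]
    · intro b _ hb
      simp [hb.symm]
  have h3 : ∀ θ, ∫ φ in (0 : ℝ)..π, (P θ - P φ) ^ 2 =
      π * P θ ^ 2 - 2 * (∫ t in (0 : ℝ)..π, P t) * P θ + ∫ t in (0 : ℝ)..π, P t ^ 2 := by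
    intro θ
    have : ∀ φ, (P θ - P φ) ^ 2 = P θ ^ 2 - 2 * P θ * P φ + P φ ^ 2 := fun φ => by ring
    simp_rw [this]
    rw [intervalIntegral.integral_add (by apply Continuous.intervalIntegrable; fun_prop)
      (by apply Continuous.intervalIntegrable; fun_prop),
      intervalIntegral.integral_sub (by apply Continuous.intervalIntegrable; fun_prop)
      (by apply Continuous.intervalIntegrable; fun_prop), intervalIntegral.integral_const_mul]
    simp
    ring
  change ∫ θ in (0 : ℝ)..π, ∫ φ in (0 : ℝ)..π, (P θ - P φ) ^ 2 = _
  simp_rw [h3]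
  rw [intervalIntegral.integral_add (by apply Continuous.intervalIntegrable; fun_prop)
      (by apply Continuous.intervalIntegrable; fun_prop),
      intervalIntegral.integral_sub (by apply Continuous.intervalIntegrable; fun_prop)
      (by apply Continuous.intervalIntegrable; fun_prop), intervalIntegral.integral_const_mul,
      intervalIntegral.integral_const_mul, h1, h2]
  simp only [intervalIntegral.integral_const, smul_eq_mul, sub_zero]
  by_cases h0 : 0 ∈ s
  · simp only [← Finset.add_sum_erase s _ h0, if_true]
    have e : ∀ f g : ℕ → ℝ, ∑ a ∈ s.erase 0, (if a = 0 then f a else g a) = ∑ a ∈ s.erase 0, g a :=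
      fun f g => Finset.sum_congr rfl fun a ha => if_neg (Finset.ne_of_mem_erase ha)
    simp only [mul_ite]
    rw [e, e, e, ← Finset.sum_mul]
    simp
    ring
  · have e : ∀ f g : ℕ → ℝ, ∑ a ∈ s, (if a = 0 then f a else g a) = ∑ a ∈ s, g a :=
      fun f g => Finset.sum_congr rfl fun a ha =>
        if_neg (ne_of_mem_of_not_mem ha h0)
    simp only [mul_ite]
    rw [e, e, e, ← Finset.sum_mul]
    simp
    ring

theorem image_cos_Ioo (γ : ℝ) (hγ : 0 < γ) :
    (fun θ => 1 + γ + 2 * √γ * cos θ) '' Ioo 0 π = Ioo ((1 - √γ) ^ 2) ((1 + √γ) ^ 2) := by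
  have hs : 0 < √γ := Real.sqrt_pos.2 hγ
  have hs2 : √γ ^ 2 = γ := Real.sq_sqrt hγ.le
  ext x
  constructor
  · rintro ⟨θ, hθ, rfl⟩
    have h1 : cos θ < 1 := by
      have := strictAntiOn_cos (left_mem_Icc.2 pi_pos.le) (Ioo_subset_Icc_self hθ) hθ.1
      simpa using this
    have h2 : -1 < cos θ := by
      have := strictAntiOn_cos (Ioo_subset_Icc_self hθ) (right_mem_Icc.2 pi_pos.le) hθ.2
      simpa using this
    constructor <;> nlinarith
  · rintro ⟨h1, h2⟩
    have h3 : -1 < (x - (1 + γ)) / (2 * √γ) := by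
      rw [lt_div_iff₀ (by positivity)]; nlinarith
    have h4 : (x - (1 + γ)) / (2 * √γ) < 1 := by
      rw [div_lt_iff₀ (by positivity)]; nlinarith
    refine ⟨arccos ((x - (1 + γ)) / (2 * √γ)), ⟨arccos_pos.2 h4, arccos_lt_pi.2 h3⟩, ?_⟩
    simp only
    rw [cos_arccos h3.le h4.le]
    field_simp
    ring

/-- The substitution `x = 1 + γ + 2√γ cos θ`; no integrability of `F` is needed. -/
theorem integral_eq_integral_cos {γ : ℝ} (hγ : 0 < γ) (F : ℝ → ℝ) :
    ∫ x in ((1 - √γ) ^ 2)..((1 + √γ) ^ 2), F x =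
      ∫ θ in Ioo 0 π, 2 * √γ * sin θ * F (1 + γ + 2 * √γ * cos θ) := by
  have hs : 0 < √γ := Real.sqrt_pos.2 hγ
  rw [intervalIntegral.integral_of_le (by nlinarith), integral_Ioc_eq_integral_Ioo,
    ← image_cos_Ioo γ hγ,
    integral_image_eq_integral_abs_deriv_smul (f' := fun θ => -(2 * √γ * sin θ)) measurableSet_Ioo]
  · refine setIntegral_congr_fun measurableSet_Ioo fun θ hθ => ?_
    have := sin_pos_of_pos_of_lt_pi hθ.1 hθ.2
    simp only [smul_eq_mul, abs_neg]
    rw [abs_of_pos (by positivity)]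
  · intro θ _
    have := ((hasDerivAt_cos θ).const_mul (2 * √γ)).const_add (1 + γ)
    rw [mul_neg] at this
    exact this.hasDerivWithinAt
  · intro θ hθ φ hφ h
    refine injOn_cos (Ioo_subset_Icc_self hθ) (Ioo_subset_Icc_self hφ) ?_
    simpa [hs.ne'] using h

/-- The integrand of `sigmaSq` in angular coordinates, Jacobians included. The hypotheses on `P` and `S`
say that `S θ φ / sin θ` is the divided difference of `P` with respect to the cosine. -/
theorem divDiff_sq_mul_eq {P : ℝ → ℝ} {S : ℝ → ℝ → ℝ} {γ θ φ : ℝ} (hγ : 0 < γ)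
    (hθ : θ ∈ Ioo 0 π) (hφ : φ ∈ Ioo 0 π) (hne : φ ≠ θ)
    (h1 : (P θ - P φ) * sin θ = (cos θ - cos φ) * S θ φ)
    (h2 : (P φ - P θ) * sin φ = (cos φ - cos θ) * S φ θ) :
    2 * √γ * sin θ * (2 * √γ * sin φ *
      (((P φ - P θ) / ((1 + γ + 2 * √γ * cos φ) - (1 + γ + 2 * √γ * cos θ))) ^ 2 *
        ((4 * γ - ((1 + γ + 2 * √γ * cos θ) - (1 + γ)) * ((1 + γ + 2 * √γ * cos φ) - (1 + γ))) /
          (√(4 * γ - ((1 + γ + 2 * √γ * cos θ) - (1 + γ)) ^ 2) *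
            √(4 * γ - ((1 + γ + 2 * √γ * cos φ) - (1 + γ)) ^ 2))))) =
      1 / 2 * (S θ φ ^ 2 + S φ θ ^ 2 + (P θ - P φ) ^ 2) := by
  have hs : 0 < √γ := Real.sqrt_pos.2 hγ
  have hs2 : √γ ^ 2 = γ := Real.sq_sqrt hγ.le
  have hsin : ∀ t ∈ Ioo 0 π, √(4 * γ - ((1 + γ + 2 * √γ * cos t) - (1 + γ)) ^ 2) = 2 * √γ * sin t := by
    intro t ht
    have := sin_pos_of_pos_of_lt_pi ht.1 ht.2
    rw [Real.sqrt_eq_iff_mul_self_eq_of_pos (by positivity)]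
    linear_combination (4 * sin t ^ 2 + 4 * cos t ^ 2) * hs2 + 4 * γ * sin_sq_add_cos_sq t
  have hc : cos φ - cos θ ≠ 0 := fun h =>
    hne (injOn_cos (Ioo_subset_Icc_self hφ) (Ioo_subset_Icc_self hθ) (sub_eq_zero.1 h))
  have p1 := sin_pos_of_pos_of_lt_pi hθ.1 hθ.2
  have p2 := sin_pos_of_pos_of_lt_pi hφ.1 hφ.2
  rw [hsin θ hθ, hsin φ hφ]
  -- `D` is the divided difference; with `z = cos θ`, `w = cos φ` the claim becomes `D²` times
  -- `1 - z w = ((1 - z²) + (1 - w²) + (z - w)²) / 2`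
  obtain ⟨D, hD⟩ : ∃ D, P φ - P θ = D * (cos φ - cos θ) :=
    ⟨(P φ - P θ) / (cos φ - cos θ), by field_simp⟩
  have e1 : S θ φ = D * sin θ := by
    refine mul_left_cancel₀ hc ?_
    linear_combination h1 + hD * sin θ
  have e2 : S φ θ = D * sin φ := by
    refine mul_left_cancel₀ hc ?_
    linear_combination -h2 + hD * sin φ
  have e3 : P θ - P φ = -(D * (cos φ - cos θ)) := by linear_combination -hD
  rw [e1, e2, e3, hD]
  have e4 : D * (cos φ - cos θ) / ((1 + γ + 2 * √γ * cos φ) - (1 + γ + 2 * √γ * cos θ)) =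
      D / (2 * √γ) := by
    rw [show (1 + γ + 2 * √γ * cos φ) - (1 + γ + 2 * √γ * cos θ) =
      2 * √γ * (cos φ - cos θ) by ring]
    field_simp
  rw [e4]
  have e5 : 4 * γ - ((1 + γ + 2 * √γ * cos θ) - (1 + γ)) * ((1 + γ + 2 * √γ * cos φ) - (1 + γ)) =
      4 * √γ ^ 2 * (1 - cos θ * cos φ) := by rw [hs2]; linear_combination (-4 * cos θ * cos φ) * hs2
  rw [e5]
  field_simp
  linear_combination (-2 * D ^ 2) * (sin_sq_add_cos_sq θ + sin_sq_add_cos_sq φ)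

theorem eval_sum_shiftedT {γ : ℝ} (hγ : 0 < γ) (c : ℕ →₀ ℝ) (θ : ℝ) :
    (c.sum fun k a => a • shiftedT γ k).eval (1 + γ + 2 * √γ * cos θ) =
      ∑ a ∈ c.support, c a * cos (a * θ) := by
  have hs : √γ ≠ 0 := (Real.sqrt_pos.2 hγ).ne'
  have hZ : (marchenkoPasturCoord γ).eval (1 + γ + 2 * √γ * cos θ) = cos θ := by
    simp [marchenkoPasturCoord]
    field_simp
  simp [Finsupp.sum, Polynomial.eval_finsetSum, shiftedT, Polynomial.eval_comp, hZ,
    Polynomial.Chebyshev.T_real_cos]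

theorem sigmaSq_eq_integral_angles {γ : ℝ} (hγ : 0 < γ) {f P : ℝ → ℝ} {S : ℝ → ℝ → ℝ}
    (hf : ∀ θ, f (1 + γ + 2 * √γ * cos θ) = P θ)
    (hS : ∀ θ φ, (P θ - P φ) * sin θ = (cos θ - cos φ) * S θ φ) :
    sigmaSq γ f = 1 / (2 * π ^ 2) * ∫ θ in (0 : ℝ)..π, ∫ φ in (0 : ℝ)..π,
      1 / 2 * (S θ φ ^ 2 + S φ θ ^ 2 + (P θ - P φ) ^ 2) := by
  rw [sigmaSq, integral_eq_integral_cos hγ, intervalIntegral.integral_of_le pi_pos.le,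
    integral_Ioc_eq_integral_Ioo]
  congr 1
  refine setIntegral_congr_fun measurableSet_Ioo fun θ hθ => ?_
  rw [integral_eq_integral_cos hγ, intervalIntegral.integral_of_le pi_pos.le,
    integral_Ioc_eq_integral_Ioo, ← integral_const_mul]
  refine setIntegral_congr_ae measurableSet_Ioo ?_
  filter_upwards [Measure.ae_ne volume θ] with φ hne hφ
  rw [hf, hf]
  exact divDiff_sq_mul_eq hγ hθ hφ hne (hS θ φ) (hS φ θ)

theorem integral_integral_half_sum_sq {P : ℝ → ℝ} {S : ℝ → ℝ → ℝ} (hP : Continuous P)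
    (hS : Continuous fun q : ℝ × ℝ => S q.1 q.2) :
    ∫ θ in (0 : ℝ)..π, ∫ φ in (0 : ℝ)..π, 1 / 2 * (S θ φ ^ 2 + S φ θ ^ 2 + (P θ - P φ) ^ 2) =
      1 / 2 * ((∫ θ in (0 : ℝ)..π, ∫ φ in (0 : ℝ)..π, S θ φ ^ 2) +
        (∫ θ in (0 : ℝ)..π, ∫ φ in (0 : ℝ)..π, S φ θ ^ 2) +
        ∫ θ in (0 : ℝ)..π, ∫ φ in (0 : ℝ)..π, (P θ - P φ) ^ 2) := by
  have h3 : ∀ θ, ∫ φ in (0 : ℝ)..π, 1 / 2 * (S θ φ ^ 2 + S φ θ ^ 2 + (P θ - P φ) ^ 2) =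
      1 / 2 * ((∫ φ in (0 : ℝ)..π, S θ φ ^ 2) + (∫ φ in (0 : ℝ)..π, S φ θ ^ 2) +
        ∫ φ in (0 : ℝ)..π, (P θ - P φ) ^ 2) := by
    intro θ
    have c1 : Continuous fun φ => S θ φ := hS.comp (Continuous.prodMk_right θ)
    have c2 : Continuous fun φ => S φ θ := hS.comp (Continuous.prodMk_left θ)
    rw [intervalIntegral.integral_const_mul,
      intervalIntegral.integral_add (by apply Continuous.intervalIntegrable; fun_prop)
        (by apply Continuous.intervalIntegrable; fun_prop),
      intervalIntegral.integral_add (by apply Continuous.intervalIntegrable; fun_prop)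
        (by apply Continuous.intervalIntegrable; fun_prop)]
  have k1 : Continuous fun θ => ∫ φ in (0 : ℝ)..π, S θ φ ^ 2 :=
    intervalIntegral.continuous_parametric_intervalIntegral_of_continuous' (hS.pow 2) _ _
  have k2 : Continuous fun θ => ∫ φ in (0 : ℝ)..π, S φ θ ^ 2 :=
    intervalIntegral.continuous_parametric_intervalIntegral_of_continuous'
      ((hS.comp continuous_swap).pow 2) _ _
  have k3 : Continuous fun θ => ∫ φ in (0 : ℝ)..π, (P θ - P φ) ^ 2 :=
    intervalIntegral.continuous_parametric_intervalIntegral_of_continuous'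
      (f := fun θ φ => (P θ - P φ) ^ 2) (by unfold Function.uncurry; fun_prop) _ _
  simp_rw [h3]
  rw [intervalIntegral.integral_const_mul,
      intervalIntegral.integral_add (by apply Continuous.intervalIntegrable; fun_prop)
        (by apply Continuous.intervalIntegrable; fun_prop),
      intervalIntegral.integral_add (by apply Continuous.intervalIntegrable; fun_prop)
        (by apply Continuous.intervalIntegrable; fun_prop)]

theorem sigmaSq_sum_shiftedT {γ : ℝ} (hγ : 0 < γ) (c : ℕ →₀ ℝ) :
    sigmaSq γ (fun x => (c.sum fun k a => a • shiftedT γ k).eval x) =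
      1 / 2 * ∑ k ∈ c.support, k * c k ^ 2 := by
  let P : ℝ → ℝ := fun t => ∑ a ∈ c.support, c a * cos (a * t)
  let S : ℝ → ℝ → ℝ := fun θ φ => ∑ a ∈ c.support, c a * cosDivDiff a θ φ
  have hP : Continuous P := by fun_prop
  have hS : Continuous (fun q : ℝ × ℝ => S q.1 q.2) := by
    simp only [S, cosDivDiff]; fun_prop
  have h1 : ∀ θ φ, (P θ - P φ) * sin θ = (cos θ - cos φ) * S θ φ := by
    intro θ φ
    simp only [P, S]
    rw [← Finset.sum_sub_distrib, Finset.sum_mul, Finset.mul_sum]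
    refine Finset.sum_congr rfl fun a _ => ?_
    linear_combination c a * cos_sub_cos_mul_sin a θ φ
  rw [sigmaSq_eq_integral_angles hγ (P := P) (eval_sum_shiftedT hγ c) h1]
  rw [integral_integral_half_sum_sq hP hS, (integral_integral_cosDivDiff_sq c.support c).1,
      (integral_integral_cosDivDiff_sq c.support c).2, integral_integral_sub_sq]
  rw [← mul_add, ← mul_add, ← Finset.sum_add_distrib, ← Finset.sum_add_distrib]
  have h4 : ∀ a ∈ c.support, ((if a = 0 then 0 else ((a : ℝ) - 1 / 2) * c a ^ 2) +
      (if a = 0 then 0 else ((a : ℝ) - 1 / 2) * c a ^ 2)) + (if a = 0 then 0 else c a ^ 2) =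
      2 * (a * c a ^ 2) := by
    intro a _
    split_ifs with h
    · simp [h]
    · ring
  rw [Finset.sum_congr rfl h4, ← Finset.mul_sum]
  field_simp

/-- Both quadratic forms equal `½ ∑ k c_k²` in Chebyshev coordinates. -/
theorem limitCov_eq_sigmaSq {γ : ℝ} (hγ : 0 < γ) (p : Polynomial ℝ) :
    limitCov γ p p = sigmaSq γ fun x => p.eval x := by
  obtain ⟨c, rfl⟩ := exists_eq_sum_shiftedT hγ p
  rw [limitCov_sum_shiftedT hγ, sigmaSq_sum_shiftedT hγ]

end LimitingVarianceIntegral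

/-! ### Integrability and integration by parts on the orthant -/

section LaguerreWeight

open MvPolynomial

/-- Lebesgue measure on `(0, ∞)^N`, as a product measure. -/
noncomputable def orthantMeasure (N : ℕ) : Measure (Fin N → ℝ) :=
  Measure.pi fun _ => (volume : Measure ℝ).restrict (Set.Ioi 0)

instance (N : ℕ) : SigmaFinite (orthantMeasure N) := by unfold orthantMeasure; infer_instance

theorem volume_restrict_orthant (N : ℕ) :
    (volume : Measure (Fin N → ℝ)).restrict {x | ∀ i, 0 < x i} = orthantMeasure N := by
  rw [orthantMeasure, ← Measure.restrict_pi_pi, ← volume_pi]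
  congr 1
  ext x; simp

theorem ae_orthantMeasure_pos (N : ℕ) : ∀ᵐ x ∂orthantMeasure N, ∀ i, 0 < x i := by
  rw [← volume_restrict_orthant]
  have h : {x : Fin N → ℝ | ∀ i, 0 < x i} = Set.univ.pi fun _ => Set.Ioi 0 := by ext x; simp
  have hm : MeasurableSet {x : Fin N → ℝ | ∀ i, 0 < x i} :=
    h ▸ MeasurableSet.univ_pi fun _ => measurableSet_Ioi
  exact ae_restrict_mem hm

/-- The Laguerre weight with `|x_j - x_i| ^ β` replaced by `((x_j - x_i)² + ε) ^ (β/2)`, and with exponent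
`a` and rate `c`; `ε = 0` gives back the original weight. -/
noncomputable def regularizedWeight (N : ℕ) (β a c ε : ℝ) (x : Fin N → ℝ) : ℝ :=
  (∏ i, ∏ j ∈ Finset.Ioi i, ((x j - x i) ^ 2 + ε) ^ (β / 2)) *
    ∏ i, (x i ^ a * Real.exp (-c * x i))

theorem laguerreWeight_eq (N : ℕ) (β M : ℝ) :
    laguerreWeight N β M =
      regularizedWeight N β (β / 2 * (M - N + 1) - 1) (β * M / 2) 0 := by
  ext x
  rw [laguerreWeight, regularizedWeight]
  congr 1
  refine Finset.prod_congr rfl fun i _ => Finset.prod_congr rfl fun j _ => ?_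
  rw [add_zero, ← sq_abs, ← Real.rpow_natCast, ← Real.rpow_mul (abs_nonneg _)]
  congr 1
  push_cast; ring

theorem measurable_regularizedWeight (N : ℕ) (β a c ε : ℝ) :
    Measurable (regularizedWeight N β a c ε) := by
  unfold regularizedWeight
  refine Measurable.mul ?_ ?_
  · refine Finset.measurable_prod _ fun i _ => Finset.measurable_prod _ fun j _ => ?_
    exact Measurable.pow_const (by fun_prop) _
  · refine Finset.measurable_prod _ fun i _ => ?_
    exact (Measurable.pow_const (by fun_prop) _).mul (by fun_prop)

theorem regularizedWeight_nonneg {N : ℕ} (β a c : ℝ) {ε : ℝ} (hε : 0 ≤ ε) {x : Fin N → ℝ}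
    (hx : ∀ i, 0 < x i) : 0 ≤ regularizedWeight N β a c ε x := by
  refine mul_nonneg ?_ ?_
  · exact Finset.prod_nonneg fun i _ => Finset.prod_nonneg fun j _ =>
      Real.rpow_nonneg (by positivity) _
  · exact Finset.prod_nonneg fun i _ =>
      mul_nonneg (Real.rpow_nonneg (hx i).le _) (Real.exp_pos _).le

theorem regularizedWeight_mono {N : ℕ} {β : ℝ} (hβ : 0 ≤ β) (a c : ℝ) {ε ε' : ℝ} (hε : 0 ≤ ε)
    (h : ε ≤ ε') {x : Fin N → ℝ} (hx : ∀ i, 0 < x i) :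
    regularizedWeight N β a c ε x ≤ regularizedWeight N β a c ε' x := by
  refine mul_le_mul_of_nonneg_right ?_ ?_
  · refine Finset.prod_le_prod (fun i _ => Finset.prod_nonneg fun j _ =>
      Real.rpow_nonneg (by positivity) _) fun i _ => ?_
    refine Finset.prod_le_prod (fun j _ => Real.rpow_nonneg (by positivity) _) fun j _ => ?_
    exact Real.rpow_le_rpow (by positivity) (by linarith) (by positivity)
  · exact Finset.prod_nonneg fun i _ =>
      mul_nonneg (Real.rpow_nonneg (hx i).le _) (Real.exp_pos _).le

/-- Every factor `(x_j - x_i)² + 1` is at most `∏ (1 + x_k)²`, so the weight is dominated by a product. -/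
theorem regularizedWeight_one_le {N : ℕ} {β : ℝ} (hβ : 0 ≤ β) (a c : ℝ) :
    ∃ B : ℝ, 0 ≤ B ∧ ∀ x : Fin N → ℝ, (∀ i, 0 < x i) →
      regularizedWeight N β a c 1 x ≤ ∏ i, ((1 + x i) ^ B * (x i ^ a * Real.exp (-c * x i))) := by
  refine ⟨β * ∑ i : Fin N, (Finset.Ioi i).card, by positivity, fun x hx => ?_⟩
  rw [Finset.prod_mul_distrib]
  refine mul_le_mul_of_nonneg_right ?_ (Finset.prod_nonneg fun i _ =>
      mul_nonneg (Real.rpow_nonneg (hx i).le _) (Real.exp_pos _).le)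
  set P : ℝ := ∏ i, (1 + x i) with hP
  have hP0 : 0 ≤ P := Finset.prod_nonneg fun i _ => by linarith [hx i]
  have hpair : ∀ i, ∀ j ∈ Finset.Ioi i, ((x j - x i) ^ 2 + 1) ^ (β / 2) ≤ P ^ β := by
    intro i j hij
    have hne : i ≠ j := (Finset.mem_Ioi.1 hij).ne
    have h1 : (1 + x i) * (1 + x j) ≤ P := by
      rw [hP, ← Finset.prod_pair (f := fun k => 1 + x k) hne]
      exact Finset.prod_le_prod_of_subset_of_one_le (Finset.subset_univ _)
        (fun k _ => by linarith [hx k]) fun k _ _ => by linarith [hx k]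
    have h2 : (x j - x i) ^ 2 + 1 ≤ P ^ 2 := by
      have hi := hx i
      have hj := hx j
      have h3 : (x j - x i) ^ 2 + 1 ≤ ((1 + x i) * (1 + x j)) ^ 2 := by
        nlinarith [mul_pos hi hj, mul_pos (mul_pos hi hj) hi, mul_pos (mul_pos hi hj) hj,
          sq_nonneg (x i * x j)]
      exact h3.trans (pow_le_pow_left₀ (by positivity) h1 2)
    calc ((x j - x i) ^ 2 + 1) ^ (β / 2) ≤ (P ^ 2) ^ (β / 2) :=
          Real.rpow_le_rpow (by positivity) h2 (by positivity)
      _ = P ^ β := by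
          rw [← Real.rpow_natCast, ← Real.rpow_mul hP0]
          congr 1
          push_cast; ring
  calc ∏ i, ∏ j ∈ Finset.Ioi i, ((x j - x i) ^ 2 + 1) ^ (β / 2)
      ≤ ∏ i : Fin N, ∏ j ∈ Finset.Ioi i, P ^ β := by
        refine Finset.prod_le_prod (fun i _ => Finset.prod_nonneg fun j _ =>
          Real.rpow_nonneg (by positivity) _) fun i _ => ?_
        exact Finset.prod_le_prod (fun j _ => Real.rpow_nonneg (by positivity) _) (hpair i)
    _ = P ^ (β * ((∑ i : Fin N, (Finset.Ioi i).card : ℕ) : ℝ)) := by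
        simp only [Finset.prod_const]
        rw [Finset.prod_pow_eq_pow_sum, Real.rpow_mul hP0, Real.rpow_natCast]
    _ = ∏ i, (1 + x i) ^ (β * ((∑ i : Fin N, (Finset.Ioi i).card : ℕ) : ℝ)) := by
        rw [hP, Real.finsetProd_rpow _ _ fun i _ => by linarith [hx i]]
    _ = _ := by push_cast; rfl

theorem integrable_pow_mul_weight {a c B : ℝ} (ha : -1 < a) (hc : 0 < c) (hB : 0 ≤ B) (d : ℕ) :
    IntegrableOn (fun t : ℝ => t ^ d * ((1 + t) ^ B * (t ^ a * Real.exp (-c * t)))) (Set.Ioi 0) := by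
  have h : ∀ s : ℝ, -1 < s → IntegrableOn (fun t : ℝ => t ^ s * Real.exp (-c * t)) (Set.Ioi 0) := by
    intro s hs
    simpa using integrableOn_rpow_mul_exp_neg_mul_rpow hs one_pos hc
  have hd : (0 : ℝ) ≤ d := Nat.cast_nonneg d
  refine Integrable.mono' (((h (d + a) (by linarith)).add (h (B + d + a) (by linarith))).const_mul
    (2 ^ B)) ?_ ?_
  · refine Measurable.aestronglyMeasurable ?_
    exact (by fun_prop : Measurable fun t : ℝ => t ^ d).mul
      ((Measurable.pow_const (by fun_prop) _).mul
        ((Measurable.pow_const (by fun_prop) _).mul (by fun_prop)))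
  · refine (ae_restrict_iff' measurableSet_Ioi).2 (Eventually.of_forall fun t ht => ?_)
    have ht : (0 : ℝ) < t := ht
    have h1 : (1 + t) ^ B ≤ 2 ^ B * (1 + t ^ B) := by
      rcases le_total t 1 with h1 | h1
      · calc (1 + t) ^ B ≤ 2 ^ B := Real.rpow_le_rpow (by positivity) (by linarith) hB
          _ ≤ 2 ^ B * (1 + t ^ B) := le_mul_of_one_le_right (by positivity)
            (by linarith [Real.rpow_nonneg ht.le B])
      · calc (1 + t) ^ B ≤ (2 * t) ^ B := Real.rpow_le_rpow (by positivity) (by linarith) hB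
          _ = 2 ^ B * t ^ B := Real.mul_rpow (by positivity) ht.le
          _ ≤ 2 ^ B * (1 + t ^ B) := by gcongr; linarith
    rw [Real.norm_of_nonneg (by positivity)]
    simp only [Pi.add_apply]
    rw [Real.rpow_add ht, add_assoc B, Real.rpow_add ht, Real.rpow_add ht, Real.rpow_natCast]
    calc t ^ d * ((1 + t) ^ B * (t ^ a * Real.exp (-c * t)))
        ≤ t ^ d * (2 ^ B * (1 + t ^ B) * (t ^ a * Real.exp (-c * t))) := by gcongr
      _ = _ := by ring

theorem integrable_eval_mul_regularizedWeight {N : ℕ} {β a c ε : ℝ} (hβ : 0 ≤ β) (ha : -1 < a)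
    (hc : 0 < c) (hε : 0 ≤ ε) (hε1 : ε ≤ 1) (P : MvPolynomial (Fin N) ℝ) :
    Integrable (fun x => eval x P * regularizedWeight N β a c ε x) (orthantMeasure N) := by
  induction P using MvPolynomial.induction_on' with
  | add p q hp hq => exact (hp.add hq).congr (ae_of_all _ fun x => by simp [add_mul])
  | monomial s r =>
    obtain ⟨B, hB0, hB⟩ := regularizedWeight_one_le (N := N) hβ a c
    have hint : Integrable (fun x : Fin N → ℝ => |r| * ∏ i,
        (x i ^ s i * ((1 + x i) ^ B * (x i ^ a * Real.exp (-c * x i))))) (orthantMeasure N) :=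
      (Integrable.fintype_prod (f := fun i (t : ℝ) =>
        t ^ s i * ((1 + t) ^ B * (t ^ a * Real.exp (-c * t)))) fun i =>
          integrable_pow_mul_weight ha hc hB0 (s i)).const_mul _
    refine hint.mono' ?_ ?_
    · exact ((MvPolynomial.continuous_eval _).measurable.mul
        (measurable_regularizedWeight N β a c ε)).aestronglyMeasurable
    · filter_upwards [ae_orthantMeasure_pos N] with x hx
      rw [eval_monomial, Finsupp.prod_fintype _ _ (by simp), Finset.prod_mul_distrib,
        Real.norm_eq_abs, abs_mul, abs_mul, mul_assoc]
      have hp : 0 ≤ ∏ i, x i ^ s i := Finset.prod_nonneg fun i _ => pow_nonneg (hx i).le _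
      rw [abs_of_nonneg hp, abs_of_nonneg (regularizedWeight_nonneg β a c hε hx)]
      gcongr
      exact (regularizedWeight_mono hβ a c hε hε1 hx).trans (hB x hx)

theorem integral_Ioi_deriv_eq_zero {f f' : ℝ → ℝ}
    (hd : ∀ t ∈ Set.Ioi (0 : ℝ), HasDerivAt f (f' t) t) (h0 : Tendsto f (𝓝[>] 0) (𝓝 0))
    (hf : IntegrableOn f (Set.Ioi 0)) (hf' : IntegrableOn f' (Set.Ioi 0)) :
    ∫ t in Set.Ioi 0, f' t = 0 := by
  have h1 := tendsto_zero_of_hasDerivAt_of_integrableOn_Ioi hd hf' hf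
  have := integral_Ioi_deriv_mul_eq_sub (u := f) (u' := f') (v := fun _ => 1) (v' := fun _ => 0)
    hd (fun t _ => hasDerivAt_const t 1) (by simpa [Pi.mul_def, Pi.add_def] using! hf') (by simpa [Pi.mul_def] using h0)
    (by simpa [Pi.mul_def] using h1)
  simpa using this

/-- Integration by parts in one coordinate: by Fubini and the one-dimensional case on almost every line. -/
theorem integral_partialDeriv_eq_zero {N : ℕ} (i : Fin N) {G G' : (Fin N → ℝ) → ℝ}
    (hG : Integrable G (orthantMeasure N)) (hG' : Integrable G' (orthantMeasure N))
    (hd : ∀ x : Fin N → ℝ, (∀ j, 0 < x j) →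
      HasDerivAt (fun t => G (Function.update x i t)) (G' x) (x i))
    (h0 : ∀ x : Fin N → ℝ, (∀ j, 0 < x j) →
      Tendsto (fun t => G (Function.update x i t)) (𝓝[>] 0) (𝓝 0)) :
    ∫ x, G' x ∂orthantMeasure N = 0 := by
  obtain ⟨n, rfl⟩ : ∃ n, N = n + 1 := ⟨N - 1, by have := i.2; omega⟩
  let e := MeasurableEquiv.piFinSuccAbove (fun _ : Fin (n + 1) => ℝ) i
  have hmp : MeasurePreserving e (orthantMeasure (n + 1))
      (((volume : Measure ℝ).restrict (Set.Ioi 0)).prod (orthantMeasure n)) :=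
    measurePreserving_piFinSuccAbove (fun _ => (volume : Measure ℝ).restrict (Set.Ioi 0)) i
  have hsymm : ∀ (t : ℝ) (y : Fin n → ℝ), e.symm (t, y) = i.insertNth t y := fun _ _ => rfl
  have key : ∀ F : (Fin (n + 1) → ℝ) → ℝ, Integrable F (orthantMeasure (n + 1)) →
      Integrable (fun z => F (e.symm z))
        (((volume : Measure ℝ).restrict (Set.Ioi 0)).prod (orthantMeasure n)) := by
    intro F hF
    exact (hmp.symm e).integrable_comp_emb e.symm.measurableEmbedding |>.2 hF
  have h1 := (hmp.symm e).integral_comp' G'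
  rw [← h1, integral_prod_symm _ (key G' hG')]
  refine integral_eq_zero_of_ae ?_
  filter_upwards [ae_orthantMeasure_pos n, (key G hG).prod_left_ae, (key G' hG').prod_left_ae]
    with y hy i1 i2
  have hpos : ∀ t : ℝ, 0 < t → ∀ j, 0 < (i.insertNth t y : Fin (n + 1) → ℝ) j := by
    intro t ht j
    refine Fin.succAboveCases i ?_ (fun j => ?_) j
    · simpa using ht
    · simpa using hy j
  have hupd : ∀ t s : ℝ, Function.update (i.insertNth t y : Fin (n + 1) → ℝ) i s = i.insertNth s y :=
    fun t s => Fin.update_insertNth _ _ _ _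
  refine integral_Ioi_deriv_eq_zero (f := fun t => G (i.insertNth t y)) ?_ ?_ i1 i2
  · intro t ht
    have := hd (i.insertNth t y) (hpos t ht)
    simpa [hupd, hsymm] using this
  · have := h0 (i.insertNth 1 y) (hpos 1 one_pos)
    simpa [hupd] using this

end LaguerreWeight

/-! ### Divergence identity for the regularized weight -/

section IntegrationByParts

open MvPolynomial

theorem hasDerivAt_eval_update {N : ℕ} (P : MvPolynomial (Fin N) ℝ) (i : Fin N) (x : Fin N → ℝ) :
    HasDerivAt (fun t => eval (Function.update x i t) P) (eval x (pderiv i P)) (x i) := by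
  induction P using MvPolynomial.induction_on with
  | C r => simpa using hasDerivAt_const (x i) r
  | add p q hp hq => simp only [map_add]; exact hp.add hq
  | mul_X p j hp =>
    have h := hasDerivAt_pi.1 (hasDerivAt_update x i (x i)) j
    have := hp.mul h
    simp only [Function.update_eq_self] at this
    convert! this using 1
    · ext t; simp
    · rw [Derivation.leibniz, pderiv_X]
      by_cases hij : i = j
      · subst hij; simp; ring
      · simp [Ne.symm hij]; ring

/-- The derivative, in the direction of the vector field `v` and up to the factor `β`, of the logarithm
of the pair interaction in `regularizedWeight`. -/
noncomputable def pairLogDeriv {N : ℕ} (ε : ℝ) (x : Fin N → ℝ) (v : Fin N → ℝ) : ℝ :=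
  ∑ p, ∑ q ∈ Finset.Ioi p, (x q - x p) * (v q - v p) / ((x q - x p) ^ 2 + ε)

theorem regularizedWeight_eq_exp {N : ℕ} (β a c : ℝ) {ε : ℝ} (hε : 0 < ε) {x : Fin N → ℝ}
    (hx : ∀ i, 0 < x i) :
    regularizedWeight N β a c ε x =
      Real.exp (∑ p, ∑ q ∈ Finset.Ioi p, β / 2 * Real.log ((x q - x p) ^ 2 + ε) +
        ∑ p, (a * Real.log (x p) - c * x p)) := by
  rw [regularizedWeight, Real.exp_add, Real.exp_sum, Real.exp_sum]
  congr 1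
  · refine Finset.prod_congr rfl fun p _ => ?_
    rw [Real.exp_sum]
    refine Finset.prod_congr rfl fun q _ => ?_
    rw [Real.rpow_def_of_pos (by positivity), mul_comm]
  · refine Finset.prod_congr rfl fun p _ => ?_
    rw [Real.rpow_def_of_pos (hx p), ← Real.exp_add]
    congr 1
    ring

theorem hasDerivAt_regularizedWeight {N : ℕ} (β a c : ℝ) {ε : ℝ} (hε : 0 < ε) (i : Fin N)
    {x : Fin N → ℝ} (hx : ∀ j, 0 < x j) :
    HasDerivAt (fun t => regularizedWeight N β a c ε (Function.update x i t))
      (regularizedWeight N β a c ε x * (β * pairLogDeriv ε x (Pi.single i 1) + a / x i - c))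
      (x i) := by
  have hu : ∀ j, HasDerivAt (fun t => Function.update x i t j)
      ((Pi.single i 1 : Fin N → ℝ) j) (x i) :=
    fun j => hasDerivAt_pi.1 (hasDerivAt_update x i (x i)) j
  have h1 : ∀ p q, HasDerivAt (fun t => β / 2 * Real.log
      ((Function.update x i t q - Function.update x i t p) ^ 2 + ε))
      (β * ((x q - x p) * ((Pi.single i 1 : Fin N → ℝ) q - (Pi.single i 1 : Fin N → ℝ) p) /
        ((x q - x p) ^ 2 + ε))) (x i) := by
    intro p q
    have hne : (x q - x p) ^ 2 + ε ≠ 0 := by positivity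
    have h2 := ((((hu q).sub (hu p)).pow 2).add_const ε).log
      (by simpa using hne) |>.const_mul (β / 2)
    convert! h2 using 1
    simp
    ring
  have h3 : ∀ p, HasDerivAt (fun t => a * Real.log (Function.update x i t p) -
      c * Function.update x i t p)
      (a * ((Pi.single i 1 : Fin N → ℝ) p / x p) - c * (Pi.single i 1 : Fin N → ℝ) p) (x i) := by
    intro p
    have h4 := (((hu p).log (by simpa using (hx p).ne')).const_mul a).sub ((hu p).const_mul c)
    convert! h4 using 1
    simp
  have h5 := (((HasDerivAt.fun_sum fun p (_ : p ∈ Finset.univ) =>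
    HasDerivAt.fun_sum fun q (_ : q ∈ Finset.Ioi p) => h1 p q).add
      (HasDerivAt.fun_sum fun p (_ : p ∈ Finset.univ) => h3 p))).exp
  have hev : ∀ᶠ t in 𝓝 (x i), regularizedWeight N β a c ε (Function.update x i t) =
      Real.exp (∑ p, ∑ q ∈ Finset.Ioi p, β / 2 * Real.log
        ((Function.update x i t q - Function.update x i t p) ^ 2 + ε) +
        ∑ p, (a * Real.log (Function.update x i t p) - c * Function.update x i t p)) := by
    filter_upwards [lt_mem_nhds (hx i)] with t ht
    refine regularizedWeight_eq_exp β a c hε fun j => ?_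
    by_cases hj : j = i
    · subst hj; simpa using ht
    · simpa [hj] using hx j
  refine HasDerivAt.congr_of_eventuallyEq ?_ hev
  convert! h5 using 1
  rw [regularizedWeight_eq_exp β a c hε hx]
  simp only [Pi.add_apply, Function.update_eq_self]
  congr 1
  have h6 : ∑ p, (a * ((Pi.single i 1 : Fin N → ℝ) p / x p) - c * (Pi.single i 1 : Fin N → ℝ) p) =
      a / x i - c := by
    rw [Finset.sum_eq_single i]
    · simp; ring
    · intro p _ hp
      simp [hp]
    · simp
  rw [h6, pairLogDeriv]
  simp only [Finset.mul_sum]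
  ring

/-- The factor `x_i ^ (k + 1)` compensates the singularity `x_i ^ a` at the boundary, as `a > -1`. -/
theorem tendsto_eval_mul_regularizedWeight_update {N : ℕ} {β a c ε : ℝ} (hβ : 0 ≤ β) (ha : -1 < a)
    (k : ℕ) (P : MvPolynomial (Fin N) ℝ) (i : Fin N) (x : Fin N → ℝ) :
    Tendsto (fun t => eval (Function.update x i t) (X i ^ (k + 1) * P) *
      regularizedWeight N β a c ε (Function.update x i t)) (𝓝[>] 0) (𝓝 0) := by
  let h : ℝ → ℝ := fun t => eval (Function.update x i t) P *
    (∏ p, ∏ q ∈ Finset.Ioi p,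
      ((Function.update x i t q - Function.update x i t p) ^ 2 + ε) ^ (β / 2)) *
    (Real.exp (-c * t) * ∏ j ∈ Finset.univ.erase i, (x j ^ a * Real.exp (-c * x j)))
  have hu : Continuous fun t => Function.update x i t := continuous_const.update i continuous_id
  have huj : ∀ j, Continuous fun t => Function.update x i t j := fun j => (continuous_apply j).comp hu
  have hh : Continuous h := by
    refine Continuous.mul (Continuous.mul ((continuous_eval P).comp hu) ?_) (by fun_prop)
    refine continuous_finsetProd _ fun p _ => continuous_finsetProd _ fun q _ => ?_
    exact ((((huj q).sub (huj p)).pow 2).add continuous_const).rpow_const fun t =>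
      Or.inr (by positivity)
  have h1 : Tendsto (fun t : ℝ => t ^ ((k : ℝ) + 1 + a)) (𝓝[>] 0) (𝓝 0) := by
    have hpos : 0 < (k : ℝ) + 1 + a := by have : (0 : ℝ) ≤ k := Nat.cast_nonneg k; linarith
    have := (Real.continuous_rpow_const hpos.le).tendsto 0
    rw [Real.zero_rpow hpos.ne'] at this
    exact this.mono_left nhdsWithin_le_nhds
  have h2 := h1.mul (hh.tendsto 0 |>.mono_left nhdsWithin_le_nhds)
  rw [zero_mul] at h2
  refine h2.congr' ?_
  filter_upwards [self_mem_nhdsWithin] with t ht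
  have ht : 0 < t := ht
  have h3 : ∏ j, (Function.update x i t j ^ a * Real.exp (-c * Function.update x i t j)) =
      t ^ a * Real.exp (-c * t) * ∏ j ∈ Finset.univ.erase i, (x j ^ a * Real.exp (-c * x j)) := by
    rw [← Finset.mul_prod_erase _ _ (Finset.mem_univ i), Function.update_self]
    congr 1
    refine Finset.prod_congr rfl fun j hj => ?_
    rw [Function.update_of_ne (Finset.ne_of_mem_erase hj)]
  have h4 : t ^ ((k : ℝ) + 1 + a) = t ^ (k + 1) * t ^ a := by
    rw [Real.rpow_add ht, ← Real.rpow_natCast]; push_cast; rfl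
  simp only [h, regularizedWeight, h3, h4, map_mul, map_pow, eval_X, Function.update_self]
  ring

theorem integrable_eval_mul_div_mul_regularizedWeight {N : ℕ} {β a c ε : ℝ} (hβ : 0 ≤ β)
    (ha : -1 < a) (hc : 0 < c) (hε : 0 < ε) (hε1 : ε ≤ 1) (P : MvPolynomial (Fin N) ℝ)
    (p q : Fin N) :
    Integrable (fun x => eval x P / ((x q - x p) ^ 2 + ε) * regularizedWeight N β a c ε x)
      (orthantMeasure N) := by
  have h := (integrable_eval_mul_regularizedWeight hβ ha hc hε.le hε1 P).bdd_mul
    (f := fun x : Fin N → ℝ => ((x q - x p) ^ 2 + ε)⁻¹) (c := ε⁻¹) ?_ ?_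
  · exact h.congr (ae_of_all _ fun x => by simp only; ring)
  · exact (by fun_prop : Measurable fun x : Fin N → ℝ => ((x q - x p) ^ 2 + ε)⁻¹).aestronglyMeasurable
  · refine ae_of_all _ fun x => ?_
    have : 0 ≤ (x q - x p) ^ 2 := sq_nonneg _
    rw [Real.norm_of_nonneg (by positivity)]
    exact inv_anti₀ hε (by linarith)

/-- The divergence of the vector field `x_i ^ (k+1) P w`, where `w` is the regularized weight. -/
noncomputable def divergenceIntegrand {N : ℕ} (β a c ε : ℝ) (k : ℕ) (P : MvPolynomial (Fin N) ℝ)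
    (x : Fin N → ℝ) : ℝ :=
  (eval x (∑ i, pderiv i (X i ^ (k + 1) * P) +
      P * (C a * psum (Fin N) ℝ k - C c * psum (Fin N) ℝ (k + 1))) +
    eval x P * (β * pairLogDeriv ε x fun i => x i ^ (k + 1))) * regularizedWeight N β a c ε x

theorem integral_divergenceIntegrand {N : ℕ} {β a c ε : ℝ} (hβ : 0 ≤ β)
    (ha : -1 < a) (hc : 0 < c) (hε : 0 < ε) (hε1 : ε ≤ 1) (k : ℕ) (P : MvPolynomial (Fin N) ℝ) :
    ∫ x, divergenceIntegrand β a c ε k P x ∂orthantMeasure N = 0 := by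
  let G' : Fin N → (Fin N → ℝ) → ℝ := fun i x =>
    eval x (pderiv i (X i ^ (k + 1) * P) + P * (C a * X i ^ k - C c * X i ^ (k + 1))) *
        regularizedWeight N β a c ε x +
      ∑ p, ∑ q ∈ Finset.Ioi p, eval x (C (β * ((Pi.single i 1 : Fin N → ℝ) q -
        (Pi.single i 1 : Fin N → ℝ) p)) * (X i ^ (k + 1) * P * (X q - X p))) /
          ((x q - x p) ^ 2 + ε) * regularizedWeight N β a c ε x
  have hG'int : ∀ i, Integrable (G' i) (orthantMeasure N) := fun i =>
    (integrable_eval_mul_regularizedWeight hβ ha hc hε.le hε1 _).add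
      (integrable_finsetSum _ fun p _ => integrable_finsetSum _ fun q _ =>
        integrable_eval_mul_div_mul_regularizedWeight hβ ha hc hε hε1 _ p q)
  have hpair : ∀ i x, ∑ p, ∑ q ∈ Finset.Ioi p, eval x (C (β * ((Pi.single i 1 : Fin N → ℝ) q -
        (Pi.single i 1 : Fin N → ℝ) p)) * (X i ^ (k + 1) * P * (X q - X p))) /
          ((x q - x p) ^ 2 + ε) * regularizedWeight N β a c ε x =
        x i ^ (k + 1) * eval x P * (β * pairLogDeriv ε x (Pi.single i 1)) *
          regularizedWeight N β a c ε x := by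
    intro i x
    simp only [pairLogDeriv, Finset.mul_sum, Finset.sum_mul]
    refine Finset.sum_congr rfl fun p _ => Finset.sum_congr rfl fun q _ => ?_
    simp only [map_mul, map_sub, map_pow, eval_C, eval_X]
    ring
  have hzero : ∀ i, ∫ x, G' i x ∂orthantMeasure N = 0 := by
    intro i
    refine integral_partialDeriv_eq_zero i
      (integrable_eval_mul_regularizedWeight hβ ha hc hε.le hε1 (X i ^ (k + 1) * P)) (hG'int i) ?_
      fun x _ => tendsto_eval_mul_regularizedWeight_update hβ ha k P i x
    intro x hx
    have h := (hasDerivAt_eval_update (X i ^ (k + 1) * P) i x).mul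
      (hasDerivAt_regularizedWeight β a c hε i hx)
    convert! h using 1
    simp only [G', hpair, Function.update_eq_self]
    simp only [map_add, map_sub, map_mul, map_pow, eval_C, eval_X]
    have := (hx i).ne'
    field_simp
    ring
  have hsum : ∀ x, divergenceIntegrand β a c ε k P x = ∑ i, G' i x := by
    intro x
    have hs : (pairLogDeriv ε x fun i => x i ^ (k + 1)) =
        ∑ i, x i ^ (k + 1) * pairLogDeriv ε x (Pi.single i 1) := by
      simp only [pairLogDeriv, Finset.mul_sum]
      rw [Finset.sum_comm]
      refine Finset.sum_congr rfl fun p _ => ?_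
      rw [Finset.sum_comm]
      refine Finset.sum_congr rfl fun q _ => ?_
      have : ∀ r : Fin N, ∑ i, x i ^ (k + 1) * (Pi.single i 1 : Fin N → ℝ) r = x r ^ (k + 1) := by
        intro r
        rw [Finset.sum_eq_single r] <;> simp +contextual [eq_comm]
      rw [← this q, ← this p, ← Finset.sum_sub_distrib, Finset.mul_sum, Finset.sum_div]
      exact Finset.sum_congr rfl fun i _ => by ring
    simp only [divergenceIntegrand, G', hpair]
    have h1 : ∑ i, x i ^ (k + 1) * eval x P * (β * pairLogDeriv ε x (Pi.single i 1)) *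
        regularizedWeight N β a c ε x =
        eval x P * (β * ∑ i, x i ^ (k + 1) * pairLogDeriv ε x (Pi.single i 1)) *
          regularizedWeight N β a c ε x := by
      rw [Finset.mul_sum, Finset.mul_sum, Finset.sum_mul]
      exact Finset.sum_congr rfl fun i _ => by ring
    rw [hs, Finset.sum_add_distrib, h1, ← Finset.sum_mul, ← map_sum, Finset.sum_add_distrib,
      ← Finset.mul_sum, Finset.sum_sub_distrib, ← Finset.mul_sum, ← Finset.mul_sum, psum, psum,
      add_mul]
  simp_rw [hsum]
  rw [integral_finsetSum _ fun i _ => hG'int i]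
  simp [hzero]

end IntegrationByParts

/-! ### Removal of the regularization -/

section LoopIdentity

open MvPolynomial

/-- The divided difference `(x_q ^ (k+1) - x_p ^ (k+1)) / (x_q - x_p)` as a polynomial. -/
noncomputable def pairDivDiff {N : ℕ} (k : ℕ) (p q : Fin N) : MvPolynomial (Fin N) ℝ :=
  ∑ l ∈ Finset.range (k + 1), X q ^ l * X p ^ (k - l)

/-- For the field `x_i ^ (k+1)` the pair interaction is non-singular: the kernel `d / (d² + ε)` is multiplied
by a second factor `d`. -/
theorem pairLogDeriv_pow {N : ℕ} (ε : ℝ) (k : ℕ) (x : Fin N → ℝ) :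
    (pairLogDeriv ε x fun i => x i ^ (k + 1)) =
      ∑ p, ∑ q ∈ Finset.Ioi p,
        (x q - x p) ^ 2 / ((x q - x p) ^ 2 + ε) * eval x (pairDivDiff k p q) := by
  refine Finset.sum_congr rfl fun p _ => Finset.sum_congr rfl fun q _ => ?_
  have h := geom_sum₂_mul (x q) (x p) (k + 1)
  rw [Nat.add_sub_cancel] at h
  simp only [pairDivDiff, map_sum, map_mul, map_pow, eval_X]
  rw [← h]
  ring

theorem measurable_divergenceIntegrand {N : ℕ} (β a c ε : ℝ) (k : ℕ)
    (P : MvPolynomial (Fin N) ℝ) : Measurable (divergenceIntegrand β a c ε k P) := by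
  unfold divergenceIntegrand pairLogDeriv
  refine Measurable.mul ?_ (measurable_regularizedWeight N β a c ε)
  refine (continuous_eval _).measurable.add ((continuous_eval _).measurable.mul ?_)
  fun_prop

theorem tendsto_regularizedWeight {N : ℕ} {β : ℝ} (hβ : 0 ≤ β) (a c : ℝ) (x : Fin N → ℝ)
    {u : ℕ → ℝ} (hu : Tendsto u atTop (𝓝 0)) :
    Tendsto (fun n => regularizedWeight N β a c (u n) x) atTop
      (𝓝 (regularizedWeight N β a c 0 x)) := by
  have hc : Continuous fun ε => regularizedWeight N β a c ε x := by
    refine Continuous.mul ?_ continuous_const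
    refine continuous_finsetProd _ fun p _ => continuous_finsetProd _ fun q _ => ?_
    exact (continuous_const.add continuous_id).rpow_const fun t => Or.inr (by positivity)
  exact (hc.tendsto 0).comp hu

theorem regularizedWeight_zero_of_eq {N : ℕ} {β : ℝ} (hβ : 0 < β) (a c : ℝ) {x : Fin N → ℝ}
    {p q : Fin N} (hpq : p < q) (h : x q = x p) : regularizedWeight N β a c 0 x = 0 := by
  rw [regularizedWeight, Finset.prod_eq_zero (Finset.mem_univ p), zero_mul]
  refine Finset.prod_eq_zero (Finset.mem_Ioi.2 hpq) ?_
  rw [h, sub_self, add_zero, zero_pow two_ne_zero, Real.zero_rpow (by positivity)]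

theorem tendsto_divergenceIntegrand {N : ℕ} {β : ℝ} (hβ : 0 < β) (a c : ℝ) (k : ℕ)
    (P : MvPolynomial (Fin N) ℝ) (x : Fin N → ℝ) {u : ℕ → ℝ} (hu : Tendsto u atTop (𝓝 0)) :
    Tendsto (fun n => divergenceIntegrand β a c (u n) k P x) atTop
      (𝓝 (eval x (∑ i, pderiv i (X i ^ (k + 1) * P) +
        P * (C a * psum (Fin N) ℝ k - C c * psum (Fin N) ℝ (k + 1)) +
          P * (C β * ∑ p, ∑ q ∈ Finset.Ioi p, pairDivDiff k p q)) *
            regularizedWeight N β a c 0 x)) := by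
  have hw := tendsto_regularizedWeight hβ.le a c x hu
  have hpair : ∀ p, ∀ q ∈ Finset.Ioi p, Tendsto (fun n =>
      (x q - x p) ^ 2 / ((x q - x p) ^ 2 + u n) * eval x (pairDivDiff k p q) *
        regularizedWeight N β a c (u n) x) atTop
      (𝓝 (eval x (pairDivDiff k p q) * regularizedWeight N β a c 0 x)) := by
    intro p q hq
    -- on the diagonal the quotient does not tend to `1`, but there the limiting weight vanishes
    by_cases hd : x q = x p
    · rw [regularizedWeight_zero_of_eq hβ a c (Finset.mem_Ioi.1 hq) hd, hd]
      simp
    · have hne : (x q - x p) ^ 2 ≠ 0 := pow_ne_zero 2 (sub_ne_zero.2 hd)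
      have h1 : Tendsto (fun n => (x q - x p) ^ 2 / ((x q - x p) ^ 2 + u n)) atTop (𝓝 1) := by
        have := (tendsto_const_nhds (x := (x q - x p) ^ 2)).div
          ((tendsto_const_nhds (x := (x q - x p) ^ 2)).add hu) (by simpa using hne)
        rw [add_zero, div_self hne] at this
        exact this
      simpa using (h1.mul_const (eval x (pairDivDiff k p q))).mul hw
  have hsum := tendsto_finsetSum Finset.univ fun p (_ : p ∈ Finset.univ) =>
    tendsto_finsetSum (Finset.Ioi p) fun q hq => hpair p q hq
  have h := (hw.const_mul (eval x (∑ i, pderiv i (X i ^ (k + 1) * P) +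
    P * (C a * psum (Fin N) ℝ k - C c * psum (Fin N) ℝ (k + 1))))).add
      (hsum.const_mul (eval x P * β))
  simp only [divergenceIntegrand, pairLogDeriv_pow]
  convert! h using 1
  · ext n
    rw [add_mul]
    congr 1
    simp only [Finset.mul_sum, Finset.sum_mul]
    exact Finset.sum_congr rfl fun p _ => Finset.sum_congr rfl fun q _ => by ring
  · rw [map_add (eval x), add_mul]
    congr 2
    simp only [map_mul, map_sum, eval_C, Finset.mul_sum, Finset.sum_mul]
    exact Finset.sum_congr rfl fun p _ => Finset.sum_congr rfl fun q _ => by ring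

theorem norm_divergenceIntegrand_le {N : ℕ} {β : ℝ} (hβ : 0 ≤ β) (a c : ℝ) {ε : ℝ} (hε : 0 < ε)
    (hε1 : ε ≤ 1) (k : ℕ) (P : MvPolynomial (Fin N) ℝ) {x : Fin N → ℝ} (hx : ∀ i, 0 < x i) :
    ‖divergenceIntegrand β a c ε k P x‖ ≤
      |eval x (∑ i, pderiv i (X i ^ (k + 1) * P) +
        P * (C a * psum (Fin N) ℝ k - C c * psum (Fin N) ℝ (k + 1))) *
          regularizedWeight N β a c 1 x| +
      ∑ p, ∑ q ∈ Finset.Ioi p,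
        |eval x (C β * P * pairDivDiff k p q) * regularizedWeight N β a c 1 x| := by
  have hw0 := regularizedWeight_nonneg β a c hε.le hx
  have hw : |regularizedWeight N β a c ε x| ≤ |regularizedWeight N β a c 1 x| := by
    have := regularizedWeight_mono hβ a c hε.le hε1 hx
    rw [abs_of_nonneg hw0]
    exact this.trans (le_abs_self _)
  rw [divergenceIntegrand, pairLogDeriv_pow, add_mul, Real.norm_eq_abs]
  refine (abs_add_le _ _).trans (add_le_add ?_ ?_)
  · rw [abs_mul, abs_mul]
    gcongr
  · simp only [Finset.mul_sum, Finset.sum_mul]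
    refine (Finset.abs_sum_le_sum_abs _ _).trans (Finset.sum_le_sum fun p _ => ?_)
    refine (Finset.abs_sum_le_sum_abs _ _).trans (Finset.sum_le_sum fun q _ => ?_)
    have h1 : |(x q - x p) ^ 2 / ((x q - x p) ^ 2 + ε)| ≤ 1 := by
      have : 0 ≤ (x q - x p) ^ 2 := sq_nonneg _
      rw [abs_of_nonneg (by positivity)]
      exact div_le_one_of_le₀ (by linarith) (by positivity)
    simp only [map_mul, eval_C, abs_mul]
    calc |eval x P| * (|β| * (|(x q - x p) ^ 2 / ((x q - x p) ^ 2 + ε)| *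
            |eval x (pairDivDiff k p q)|)) * |regularizedWeight N β a c ε x|
        ≤ |eval x P| * (|β| * (1 * |eval x (pairDivDiff k p q)|)) *
            |regularizedWeight N β a c 1 x| := by gcongr
      _ = _ := by ring

/-- The divergence identity for the original weight, by dominated convergence as `ε → 0`. -/
theorem integral_divergence_eq_zero {N : ℕ} {β a c : ℝ} (hβ : 0 < β) (ha : -1 < a) (hc : 0 < c)
    (k : ℕ) (P : MvPolynomial (Fin N) ℝ) :
    ∫ x, eval x (∑ i, pderiv i (X i ^ (k + 1) * P) +
        P * (C a * psum (Fin N) ℝ k - C c * psum (Fin N) ℝ (k + 1)) +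
          P * (C β * ∑ p, ∑ q ∈ Finset.Ioi p, pairDivDiff k p q)) *
            regularizedWeight N β a c 0 x ∂orthantMeasure N = 0 := by
  have hu : Tendsto (fun n : ℕ => 1 / ((n : ℝ) + 1)) atTop (𝓝 0) :=
    tendsto_one_div_add_atTop_nhds_zero_nat
  have hu0 : ∀ n : ℕ, 0 < 1 / ((n : ℝ) + 1) := fun n => by positivity
  have hu1 : ∀ n : ℕ, 1 / ((n : ℝ) + 1) ≤ 1 := fun n => by
    rw [div_le_one (by positivity)]
    linarith [(Nat.cast_nonneg n : (0 : ℝ) ≤ n)]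
  have hI := fun Q => (integrable_eval_mul_regularizedWeight (N := N) (ε := 1) hβ.le ha hc
    zero_le_one le_rfl Q).abs
  have h := tendsto_integral_of_dominated_convergence (μ := orthantMeasure N)
    (F := fun (n : ℕ) x => divergenceIntegrand β a c (1 / ((n : ℝ) + 1)) k P x) _
    (fun n => (measurable_divergenceIntegrand β a c _ k P).aestronglyMeasurable)
    ((hI _).add (integrable_finsetSum Finset.univ fun p _ =>
      integrable_finsetSum (Finset.Ioi p) fun q _ => hI (C β * P * pairDivDiff k p q)))
    (fun n => by
      filter_upwards [ae_orthantMeasure_pos N] with x hx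
      exact norm_divergenceIntegrand_le hβ.le a c (hu0 n) (hu1 n) k P hx)
    (ae_of_all _ fun x => tendsto_divergenceIntegrand hβ a c k P x hu)
  simp only [fun n : ℕ => integral_divergenceIntegrand hβ.le ha hc (hu0 n) (hu1 n) k P] at h
  exact (tendsto_nhds_unique h tendsto_const_nhds)

theorem two_mul_sum_pairDivDiff (N k : ℕ) :
    2 * ∑ p : Fin N, ∑ q ∈ Finset.Ioi p, pairDivDiff k p q =
      ∑ l ∈ Finset.range (k + 1), psum (Fin N) ℝ l * psum (Fin N) ℝ (k - l) -
        (k + 1) * psum (Fin N) ℝ k := by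
  have hsymm : ∀ p q : Fin N, pairDivDiff k p q = pairDivDiff k q p := by
    intro p q
    rw [pairDivDiff, pairDivDiff, ← Finset.sum_range_reflect]
    refine Finset.sum_congr rfl fun l hl => ?_
    have : l ≤ k := Nat.lt_succ_iff.1 (Finset.mem_range.1 hl)
    rw [show k + 1 - 1 - l = k - l by omega, show k - (k - l) = l by omega, mul_comm]
  have hdiag : ∀ p : Fin N, pairDivDiff k p p = ((k : MvPolynomial (Fin N) ℝ) + 1) * X p ^ k := by
    intro p
    rw [pairDivDiff, Finset.sum_congr rfl (g := fun _ => X p ^ k)]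
    · simp
    · intro l hl
      have : l ≤ k := Nat.lt_succ_iff.1 (Finset.mem_range.1 hl)
      rw [← pow_add, Nat.add_sub_cancel' this]
  have hall : ∑ p : Fin N, ∑ q : Fin N, pairDivDiff k p q =
      ∑ l ∈ Finset.range (k + 1), psum (Fin N) ℝ l * psum (Fin N) ℝ (k - l) := by
    simp only [pairDivDiff, psum, Finset.sum_mul_sum]
    rw [Finset.sum_comm]
    simp_rw [Finset.sum_comm (s := Finset.univ) (t := Finset.range (k + 1))]
  have hlow : ∑ p : Fin N, ∑ q ∈ Finset.Iio p, pairDivDiff k p q =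
      ∑ p : Fin N, ∑ q ∈ Finset.Ioi p, pairDivDiff k p q := by
    rw [Finset.sum_comm' (t' := Finset.univ) (s' := fun q => Finset.Ioi q) (by simp)]
    exact Finset.sum_congr rfl fun p _ => Finset.sum_congr rfl fun q _ => hsymm _ _
  have hsplit : ∀ p : Fin N, ∑ q : Fin N, pairDivDiff k p q =
      ∑ q ∈ Finset.Iio p, pairDivDiff k p q + ((k : MvPolynomial (Fin N) ℝ) + 1) * X p ^ k +
        ∑ q ∈ Finset.Ioi p, pairDivDiff k p q := by
    intro p
    rw [← hdiag p, add_comm (∑ q ∈ Finset.Iio p, _), ← Finset.sum_insert (by simp),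
      ← Finset.sum_union]
    · refine Finset.sum_congr ?_ fun _ _ => rfl
      ext q
      have := lt_trichotomy q p
      simp only [Finset.mem_univ, Finset.mem_union, Finset.mem_insert, Finset.mem_Iio,
        Finset.mem_Ioi, true_iff]
      tauto
    · rw [Finset.disjoint_left]
      intro q hq hq'
      have h1 := Finset.mem_Ioi.1 hq'
      rcases Finset.mem_insert.1 hq with h | h
      · exact absurd h h1.ne'
      · exact absurd (Finset.mem_Iio.1 h) h1.not_gt
  rw [← hall, Finset.sum_congr rfl fun p _ => hsplit p, Finset.sum_add_distrib,
    Finset.sum_add_distrib, hlow, psum, ← Finset.mul_sum]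
  ring

end LoopIdentity

/-! ### Loop equations and variance of the ensemble -/

section Ensemble

open MvPolynomial

theorem laguerreExponent_gt {N : ℕ} {β M : ℝ} (hβ : 0 < β) (hM : (N : ℝ) - 1 < M) :
    -1 < β / 2 * (M - N + 1) - 1 := by
  have : 0 < β / 2 * (M - N + 1) := mul_pos (by linarith) (by linarith)
  linarith

theorem laguerreRate_pos {N : ℕ} {β M : ℝ} (hN : 1 ≤ N) (hβ : 0 < β) (hM : (N : ℝ) - 1 < M) :
    0 < M ∧ 0 < β * M / 2 := by
  have : (1 : ℝ) ≤ N := by exact_mod_cast hN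
  have hM0 : 0 < M := by linarith
  exact ⟨hM0, by positivity⟩

theorem measurable_laguerreWeight (N : ℕ) (β M : ℝ) : Measurable (laguerreWeight N β M) := by
  rw [laguerreWeight_eq]
  exact measurable_regularizedWeight _ _ _ _ _

theorem laguerreUnnormalized_eq (N : ℕ) (β M : ℝ) : laguerreUnnormalized N β M =
    (orthantMeasure N).withDensity fun x => ENNReal.ofReal (laguerreWeight N β M x) := by
  rw [laguerreUnnormalized, volume_restrict_orthant]

theorem laguerreWeight_nonneg {N : ℕ} (β M : ℝ) {x : Fin N → ℝ} (hx : ∀ i, 0 < x i) :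
    0 ≤ laguerreWeight N β M x := by
  rw [laguerreWeight_eq]
  exact regularizedWeight_nonneg _ _ _ le_rfl hx

theorem integrable_eval_mul_laguerreWeight {N : ℕ} {β M : ℝ} (hN : 1 ≤ N) (hβ : 0 < β)
    (hM : (N : ℝ) - 1 < M) (P : MvPolynomial (Fin N) ℝ) :
    Integrable (fun x => eval x P * laguerreWeight N β M x) (orthantMeasure N) := by
  rw [laguerreWeight_eq]
  exact integrable_eval_mul_regularizedWeight hβ.le (laguerreExponent_gt hβ hM)
    (laguerreRate_pos hN hβ hM).2 le_rfl zero_le_one P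

theorem laguerreUnnormalized_univ_ne_top {N : ℕ} {β M : ℝ} (hN : 1 ≤ N) (hβ : 0 < β)
    (hM : (N : ℝ) - 1 < M) : laguerreUnnormalized N β M Set.univ ≠ ⊤ := by
  rw [laguerreUnnormalized_eq, withDensity_apply _ MeasurableSet.univ, Measure.restrict_univ,
    ← ofReal_integral_eq_lintegral_ofReal]
  · exact ENNReal.ofReal_ne_top
  · simpa using integrable_eval_mul_laguerreWeight hN hβ hM 1
  · filter_upwards [ae_orthantMeasure_pos N] with x hx
    exact laguerreWeight_nonneg β M hx

/-- The weight is positive on the box `∏ (i, i + 1)`, where the coordinates are distinct. -/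
theorem laguerreUnnormalized_univ_ne_zero (N : ℕ) (β M : ℝ) :
    laguerreUnnormalized N β M Set.univ ≠ 0 := by
  rw [laguerreUnnormalized_eq, Measure.measure_univ_ne_zero, Ne, withDensity_eq_zero_iff
    (measurable_laguerreWeight N β M).ennreal_ofReal.aemeasurable]
  intro h
  have hsub : (Set.univ.pi fun i : Fin N => Set.Ioo (i : ℝ) (i + 1)) ⊆
      {x | ¬ ENNReal.ofReal (laguerreWeight N β M x) = 0} := by
    intro x hx
    have hx : ∀ i : Fin N, x i ∈ Set.Ioo (i : ℝ) (i + 1) := fun i => hx i trivial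
    have hpos : ∀ i, 0 < x i := fun i => (Nat.cast_nonneg _).trans_lt (hx i).1
    rw [Set.mem_ofPred_eq, ENNReal.ofReal_eq_zero, not_le]
    refine mul_pos (Finset.prod_pos fun i _ => Finset.prod_pos fun j hj => ?_)
      (Finset.prod_pos fun i _ => mul_pos (Real.rpow_pos_of_pos (hpos i) _) (Real.exp_pos _))
    have hij : (i : ℕ) + 1 ≤ j := Finset.mem_Ioi.1 hj
    have hij' : ((i : ℕ) : ℝ) + 1 ≤ (j : ℕ) := by exact_mod_cast hij
    have h1 := (hx i).2
    have h2 := (hx j).1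
    exact Real.rpow_pos_of_pos (abs_pos.2 (by linarith)) _
  have h0 := measure_mono_null hsub (ae_iff.1 h)
  rw [orthantMeasure, Measure.pi_pi, Finset.prod_eq_zero_iff] at h0
  obtain ⟨i, -, hi⟩ := h0
  have hss : Set.Ioo ((i : ℕ) : ℝ) (i + 1) ⊆ Set.Ioi 0 := fun t ht =>
    lt_of_le_of_lt (Nat.cast_nonneg _) ht.1
  rw [Measure.restrict_apply measurableSet_Ioo, Set.inter_eq_left.2 hss, Real.volume_Ioo] at hi
  norm_num at hi

theorem isProbabilityMeasure_laguerreEnsemble {N : ℕ} {β M : ℝ} (hN : 1 ≤ N) (hβ : 0 < β)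
    (hM : (N : ℝ) - 1 < M) : IsProbabilityMeasure (laguerreEnsemble N β M) :=
  ⟨by
    rw [laguerreEnsemble, Measure.smul_apply, smul_eq_mul]
    exact ENNReal.inv_mul_cancel (laguerreUnnormalized_univ_ne_zero N β M)
      (laguerreUnnormalized_univ_ne_top hN hβ hM)⟩

theorem integrable_eval_laguerreEnsemble {N : ℕ} {β M : ℝ} (hN : 1 ≤ N) (hβ : 0 < β)
    (hM : (N : ℝ) - 1 < M) (P : MvPolynomial (Fin N) ℝ) :
    Integrable (fun x => eval x P) (laguerreEnsemble N β M) := by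
  refine Integrable.smul_measure ?_ (ENNReal.inv_ne_top.2 (laguerreUnnormalized_univ_ne_zero N β M))
  rw [laguerreUnnormalized_eq, integrable_withDensity_iff
    (measurable_laguerreWeight N β M).ennreal_ofReal (ae_of_all _ fun x => ENNReal.ofReal_lt_top)]
  refine (integrable_eval_mul_laguerreWeight hN hβ hM P).congr ?_
  filter_upwards [ae_orthantMeasure_pos N] with x hx
  rw [ENNReal.toReal_ofReal (laguerreWeight_nonneg β M hx)]

theorem integral_laguerreEnsemble {N : ℕ} (β M : ℝ) (f : (Fin N → ℝ) → ℝ) :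
    ∫ x, f x ∂laguerreEnsemble N β M = (laguerreUnnormalized N β M Set.univ)⁻¹.toReal *
      ∫ x, f x * laguerreWeight N β M x ∂orthantMeasure N := by
  rw [laguerreEnsemble, integral_smul_measure, smul_eq_mul]
  congr 1
  rw [laguerreUnnormalized_eq, integral_withDensity_eq_integral_toReal_smul₀
    (measurable_laguerreWeight N β M).ennreal_ofReal.aemeasurable
    (ae_of_all _ fun x => ENNReal.ofReal_lt_top)]
  refine integral_congr_ae ?_
  filter_upwards [ae_orthantMeasure_pos N] with x hx
  rw [ENNReal.toReal_ofReal (laguerreWeight_nonneg β M hx), smul_eq_mul, mul_comm]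

/-- The polynomial `u_j = N⁻¹ ∑ x_i ^ j`. -/
noncomputable def normalizedPowerSum (N : ℕ) (j : ℕ) : MvPolynomial (Fin N) ℝ :=
  C (1 / (N : ℝ)) * psum (Fin N) ℝ j

/-- The product of the `u_j` over the list `L`. -/
noncomputable def powerSumProduct (N : ℕ) (L : List ℕ) : MvPolynomial (Fin N) ℝ :=
  (L.map (normalizedPowerSum N)).prod

theorem powerSumProduct_cons (N : ℕ) (j : ℕ) (L : List ℕ) :
    powerSumProduct N (j :: L) = normalizedPowerSum N j * powerSumProduct N L := by
  simp [powerSumProduct]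

/-- The derivation `∑ x_i ^ (k+1) ∂_i`, as a function. -/
noncomputable def powerField (N k : ℕ) (P : MvPolynomial (Fin N) ℝ) : MvPolynomial (Fin N) ℝ :=
  ∑ i, X i ^ (k + 1) * pderiv i P

theorem powerField_mul (N k : ℕ) (P Q : MvPolynomial (Fin N) ℝ) :
    powerField N k (P * Q) = P * powerField N k Q + Q * powerField N k P := by
  simp only [powerField, Finset.mul_sum, ← Finset.sum_add_distrib, Derivation.leibniz, smul_eq_mul]
  exact Finset.sum_congr rfl fun i _ => by ring

theorem powerField_normalizedPowerSum (N k j : ℕ) :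
    powerField N k (normalizedPowerSum N j) = j * normalizedPowerSum N (k + j) := by
  have h : ∀ i : Fin N, pderiv i (psum (Fin N) ℝ j) = (j : MvPolynomial (Fin N) ℝ) * X i ^ (j - 1) := by
    intro i
    rw [psum, map_sum, Finset.sum_eq_single i]
    · rw [Derivation.leibniz_pow, pderiv_X_self]; simp
    · intro m _ hm
      rw [Derivation.leibniz_pow, pderiv_X_of_ne hm]; simp
    · simp
  simp only [powerField, normalizedPowerSum, Derivation.leibniz, pderiv_C, h, smul_eq_mul, mul_zero,
    add_zero]
  rw [psum, Finset.mul_sum, Finset.mul_sum]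
  refine Finset.sum_congr rfl fun i _ => ?_
  rcases j with _ | j
  · simp
  · rw [Nat.add_sub_cancel]; ring

theorem powerField_powerSumProduct (N k : ℕ) (L : List ℕ) :
    powerField N k (powerSumProduct N L) =
      ∑ i : Fin L.length, (L[i] : MvPolynomial (Fin N) ℝ) *
        powerSumProduct N ((k + L[i]) :: L.eraseIdx i) := by
  induction L with
  | nil => simp [powerSumProduct, powerField]
  | cons j L ih =>
    rw [powerSumProduct_cons, powerField_mul, powerField_normalizedPowerSum, ih]
    change _ = ∑ i : Fin (L.length + 1), _
    rw [Fin.sum_univ_succ, Finset.mul_sum, add_comm]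
    congr 1
    · simp [powerSumProduct_cons]; ring
    · refine Finset.sum_congr rfl fun i _ => ?_
      simp [powerSumProduct_cons]; ring

theorem sum_pderiv_mul (N k : ℕ) (P : MvPolynomial (Fin N) ℝ) :
    ∑ i, pderiv i (X i ^ (k + 1) * P) = powerField N k P +
      ((k : MvPolynomial (Fin N) ℝ) + 1) * psum (Fin N) ℝ k * P := by
  simp only [powerField, psum, Finset.mul_sum, Finset.sum_mul, ← Finset.sum_add_distrib]
  refine Finset.sum_congr rfl fun i _ => ?_
  rw [Derivation.leibniz, Derivation.leibniz_pow, pderiv_X_self]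
  simp
  ring

/-- Expectation under the `β`-Laguerre ensemble, as a linear functional on polynomials in the particles. -/
noncomputable def laguerreMean {N : ℕ} {β M : ℝ} (hN : 1 ≤ N) (hβ : 0 < β)
    (hM : (N : ℝ) - 1 < M) : MvPolynomial (Fin N) ℝ →ₗ[ℝ] ℝ where
  toFun P := ∫ x, eval x P ∂laguerreEnsemble N β M
  map_add' P Q := by
    simp only [map_add]
    exact integral_add (integrable_eval_laguerreEnsemble hN hβ hM P)
      (integrable_eval_laguerreEnsemble hN hβ hM Q)
  map_smul' r P := by
    simp only [smul_eval, RingHom.id_apply, smul_eq_mul]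
    exact integral_const_mul _ _

theorem laguerreMean_divergence {N : ℕ} {β M : ℝ} (hN : 1 ≤ N) (hβ : 0 < β)
    (hM : (N : ℝ) - 1 < M) (k : ℕ) (P : MvPolynomial (Fin N) ℝ) :
    laguerreMean hN hβ hM (∑ i, pderiv i (X i ^ (k + 1) * P) +
        P * (C (β / 2 * (M - N + 1) - 1) * psum (Fin N) ℝ k -
          C (β * M / 2) * psum (Fin N) ℝ (k + 1)) +
          P * (C β * ∑ p, ∑ q ∈ Finset.Ioi p, pairDivDiff k p q)) = 0 := by
  change ∫ x, _ ∂laguerreEnsemble N β M = 0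
  rw [integral_laguerreEnsemble, laguerreWeight_eq, integral_divergence_eq_zero hβ
    (laguerreExponent_gt hβ hM) (laguerreRate_pos hN hβ hM).2, mul_zero]

/-- The loop equation for a general polynomial `P`. -/
theorem laguerreMean_loop {N : ℕ} {β M : ℝ} (hN : 1 ≤ N) (hβ : 0 < β)
    (hM : (N : ℝ) - 1 < M) {g h n : ℝ} (hg : g = N / M) (hh : h = 1 / (β * N)) (hn : n = 1 / N)
    (k : ℕ) (P : MvPolynomial (Fin N) ℝ) :
    laguerreMean hN hβ hM (normalizedPowerSum N (k + 1) * P) =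
      g * ∑ l ∈ Finset.range (k + 1), laguerreMean hN hβ hM
        (normalizedPowerSum N l * (normalizedPowerSum N (k - l) * P)) +
      ((1 - g) + k * g * (2 * h - n)) * laguerreMean hN hβ hM (normalizedPowerSum N k * P) +
      2 * g * h * n * laguerreMean hN hβ hM (powerField N k P) := by
  obtain ⟨hM0, hc⟩ := laguerreRate_pos hN hβ hM
  have hN0 : (N : ℝ) ≠ 0 := by positivity
  have hM0' := hM0.ne'
  have hβ0 := hβ.ne'
  set S : MvPolynomial (Fin N) ℝ := ∑ p, ∑ q ∈ Finset.Ioi p, pairDivDiff k p q with hS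
  have h2 : 2 * S = ∑ l ∈ Finset.range (k + 1), psum (Fin N) ℝ l * psum (Fin N) ℝ (k - l) -
        (k + 1) * psum (Fin N) ℝ k := two_mul_sum_pairDivDiff N k
  have hdiv := laguerreMean_divergence hN hβ hM k P
  rw [← hS, sum_pderiv_mul] at hdiv
  -- multiplication by `r` turns the coefficient `β M / 2` of `p_{k+1}` into `1 / N`
  set r : ℝ := 1 / (β * M / 2 * N) with hr
  have e1 : (C r * C (β * M / 2) : MvPolynomial (Fin N) ℝ) = C n := by
    rw [← C_mul, hr, hn]; congr 1; field_simp
  have e2 : (C r * C β : MvPolynomial (Fin N) ℝ) = 2 * C g * C n * C n := by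
    rw [← map_ofNat C 2, ← C_mul, ← C_mul, ← C_mul, ← C_mul, hr, hn, hg]; congr 1; field_simp
  have e3 : (C r * (((k : MvPolynomial (Fin N) ℝ) + 1) + C (β / 2 * (M - N + 1) - 1)) -
      ((k : MvPolynomial (Fin N) ℝ) + 1) * C g * C n * C n) =
      C ((1 - g) + k * g * (2 * h - n)) * C n := by
    rw [← map_natCast C k, ← C_1, ← C_add, ← C_add, ← C_mul, ← C_mul, ← C_mul, ← C_mul, ← C_mul,
      ← C_sub, hr, hn, hg, hh]
    congr 1
    field_simp
    ring
  have e4 : (C r : MvPolynomial (Fin N) ℝ) = C (2 * g * h * n) := by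
    rw [hr, hn, hg, hh]; congr 1; field_simp
  have h3 : ∑ l ∈ Finset.range (k + 1),
      normalizedPowerSum N l * (normalizedPowerSum N (k - l) * P) =
      C n * C n * P * ∑ l ∈ Finset.range (k + 1), psum (Fin N) ℝ l * psum (Fin N) ℝ (k - l) := by
    rw [Finset.mul_sum, hn]
    exact Finset.sum_congr rfl fun l _ => by simp only [normalizedPowerSum]; ring
  have h4 : ∀ j, normalizedPowerSum N j = C n * psum (Fin N) ℝ j := fun j => by
    rw [normalizedPowerSum, hn]
  have key : normalizedPowerSum N (k + 1) * P + r • (powerField N k P +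
      ((k : MvPolynomial (Fin N) ℝ) + 1) * psum (Fin N) ℝ k * P +
        P * (C (β / 2 * (M - N + 1) - 1) * psum (Fin N) ℝ k -
          C (β * M / 2) * psum (Fin N) ℝ (k + 1)) + P * (C β * S)) =
      g • ∑ l ∈ Finset.range (k + 1),
        normalizedPowerSum N l * (normalizedPowerSum N (k - l) * P) +
      ((1 - g) + k * g * (2 * h - n)) • (normalizedPowerSum N k * P) +
      (2 * g * h * n) • powerField N k P := by
    rw [h3]
    simp only [smul_eq_C_mul, h4]
    linear_combination (-psum (Fin N) ℝ (k + 1) * P) * e1 + P * S * e2 + C g * C n * C n * P * h2 +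
      psum (Fin N) ℝ k * P * e3 + powerField N k P * e4
  have := congrArg (laguerreMean hN hβ hM) key
  simpa only [map_add, map_smul, hdiv, mul_zero, add_zero, map_sum, smul_eq_mul] using this

theorem normalizedPowerSum_zero {N : ℕ} (hN : 1 ≤ N) : normalizedPowerSum N 0 = 1 := by
  have : (N : ℝ) ≠ 0 := by positivity
  rw [normalizedPowerSum, psum_zero, Fintype.card_fin, ← map_natCast C N, ← C_mul,
    one_div_mul_cancel this, C_1]

theorem laguerreMean_powerSumProduct {N : ℕ} {β M : ℝ} (hN : 1 ≤ N) (hβ : 0 < β)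
    (hM : (N : ℝ) - 1 < M) (L : List ℕ) :
    laguerreMean hN hβ hM (powerSumProduct N L) =
      loopMoment (N / M) (1 / (β * N)) (1 / N : ℝ) L := by
  generalize hg : (N / M : ℝ) = g
  generalize hh : 1 / (β * N) = h
  generalize hn : (1 / N : ℝ) = n
  fun_induction loopMoment g h n L with
  | case1 =>
    have := isProbabilityMeasure_laguerreEnsemble hN hβ hM
    change ∫ x, eval x 1 ∂laguerreEnsemble N β M = 1
    simp
  | case2 L ih => rw [powerSumProduct_cons, normalizedPowerSum_zero hN, one_mul, ih]
  | case3 k L ih1 ih2 ih3 =>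
    rw [powerSumProduct_cons, laguerreMean_loop hN hβ hM hg.symm hh.symm hn.symm,
      powerField_powerSumProduct, Finset.sum_range]
    simp only [← powerSumProduct_cons]
    have hC : ∀ (a : ℕ) (Q : MvPolynomial (Fin N) ℝ),
        laguerreMean hN hβ hM (a * Q) = a * laguerreMean hN hβ hM Q := by
      intro a Q
      rw [← map_natCast C a, ← smul_eq_C_mul, map_smul, smul_eq_mul]
    rw [map_sum]
    simp only [hC, ih1, ih2, ih3]

theorem linearStatistic_eq_eval {N : ℕ} (p : Polynomial ℝ) (x : Fin N → ℝ) :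
    linearStatistic N p x =
      eval x (∑ a ∈ Finset.range (p.natDegree + 1), p.coeff a • normalizedPowerSum N a) := by
  rw [linearStatistic, empiricalMeasure, integral_smul_measure,
    integral_finsetSum_measure fun i _ => integrable_dirac (by simp)]
  simp only [integral_dirac, map_sum, smul_eval, normalizedPowerSum, map_mul, eval_C, psum, map_pow,
    eval_X, Polynomial.eval_eq_sum_range, smul_eq_mul]
  rw [Finset.sum_comm, Finset.mul_sum]
  refine Finset.sum_congr rfl fun a _ => ?_
  rw [← Finset.mul_sum]
  simp
  ring

theorem memLp_linearStatistic {N : ℕ} {β M : ℝ} (hN : 1 ≤ N) (hβ : 0 < β)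
    (hM : (N : ℝ) - 1 < M) (p : Polynomial ℝ) :
    MemLp (linearStatistic N p) 2 (laguerreEnsemble N β M) := by
  rw [funext (linearStatistic_eq_eval p), memLp_two_iff_integrable_sq
    (continuous_eval _).aestronglyMeasurable]
  simp only [← map_pow]
  exact integrable_eval_laguerreEnsemble hN hβ hM _

/-- The rescaled variance `β N² Var⟨L_N, p⟩` as a polynomial in `g = N/M`, `h = 1/(βN)`, `n = 1/N`. -/
noncomputable def loopVariance (p : Polynomial ℝ) (g h n : ℝ) : ℝ :=
  ∑ a ∈ Finset.range (p.natDegree + 1), ∑ b ∈ Finset.range (p.natDegree + 1),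
    p.coeff a * p.coeff b * loopCov g h n [a] [b]

theorem continuous_loopVariance (p : Polynomial ℝ) :
    Continuous fun x : ℝ × ℝ × ℝ => loopVariance p x.1 x.2.1 x.2.2 :=
  continuous_finsetSum _ fun a _ => continuous_finsetSum _ fun b _ =>
    continuous_const.mul (continuous_loopCov [a] [b])

theorem varLN_eq {N : ℕ} {β M : ℝ} (hN : 1 ≤ N) (hβ : 0 < β) (hM : (N : ℝ) - 1 < M)
    (p : Polynomial ℝ) :
    varLN N β M p =
      1 / (β * N) * (1 / N) * loopVariance p (N / M) (1 / (β * N)) (1 / N) := by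
  have := isProbabilityMeasure_laguerreEnsemble hN hβ hM
  set Q : MvPolynomial (Fin N) ℝ :=
    ∑ a ∈ Finset.range (p.natDegree + 1), p.coeff a • normalizedPowerSum N a with hQ
  have h1 : varLN N β M p = laguerreMean hN hβ hM (Q * Q) - laguerreMean hN hβ hM Q ^ 2 := by
    rw [varLN, variance_eq_sub (memLp_linearStatistic hN hβ hM p),
      funext (linearStatistic_eq_eval p)]
    simp only [laguerreMean, LinearMap.coe_mk, AddHom.coe_mk, ← sq, Pi.pow_apply, map_pow, ← hQ]
  have hs : ∀ a, normalizedPowerSum N a = powerSumProduct N [a] := fun a => by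
    simp [powerSumProduct]
  have hd : ∀ a b, normalizedPowerSum N a * normalizedPowerSum N b =
      powerSumProduct N ([a] ++ [b]) := fun a b => by simp [powerSumProduct]
  rw [h1, sq, hQ, Finset.sum_mul_sum]
  simp only [map_sum, map_smul, smul_mul_smul_comm, hd]
  simp only [hs, laguerreMean_powerSumProduct, smul_eq_mul]
  rw [Finset.sum_mul_sum, ← Finset.sum_sub_distrib, loopVariance, Finset.mul_sum]
  refine Finset.sum_congr rfl fun a _ => ?_
  rw [← Finset.sum_sub_distrib, Finset.mul_sum]
  refine Finset.sum_congr rfl fun b _ => ?_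
  rw [loopMoment_append]
  ring

theorem rescaled_varLN_eq {N : ℕ} {β M : ℝ} (hN : 1 ≤ N) (hβ : 0 < β) (hM : (N : ℝ) - 1 < M)
    (p : Polynomial ℝ) :
    β * (N : ℝ) ^ 2 * varLN N β M p = loopVariance p (N / M) (1 / (β * N)) (1 / N) := by
  have hN0 : (N : ℝ) ≠ 0 := by positivity
  rw [varLN_eq hN hβ hM]
  field_simp

theorem tendsto_rescaled_varLN (p : Polynomial ℝ) {γ h : ℝ} {β M : ℕ → ℝ}
    (hβ : ∀ N, 1 ≤ N → 0 < β N) (hM : ∀ N : ℕ, 1 ≤ N → (N : ℝ) - 1 < M N)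
    (hγ : Tendsto (fun N : ℕ => (N : ℝ) / M N) atTop (𝓝 γ))
    (hh : Tendsto (fun N : ℕ => 1 / (β N * N)) atTop (𝓝 h)) :
    Tendsto (fun N : ℕ => β N * (N : ℝ) ^ 2 * varLN N (β N) (M N) p) atTop
      (𝓝 (loopVariance p γ h 0)) := by
  have h1 := (continuous_loopVariance p).tendsto (γ, h, 0) |>.comp
    (hγ.prodMk_nhds (hh.prodMk_nhds (tendsto_one_div_atTop_nhds_zero_nat (𝕜 := ℝ))))
  refine h1.congr' ?_
  filter_upwards [eventually_ge_atTop 1] with N hN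
  exact (rescaled_varLN_eq hN (hβ N hN) (hM N hN) p).symm

end Ensemble

theorem corollary4 (p : Polynomial ℝ) (γ : ℝ) (hγ0 : 0 < γ) (hγ1 : γ < 1) :
    -- the law is a probability measure and the linear statistics have a variance
    (∀ (N : ℕ) (β M : ℝ), 1 ≤ N → 0 < β → (N : ℝ) - 1 < M →
      IsProbabilityMeasure (laguerreEnsemble N β M) ∧
      MemLp (linearStatistic N p) 2 (laguerreEnsemble N β M)) ∧
    ∃ ℓ : ℕ → Polynomial ℝ,
      -- the expansion of the variance, for `M = N / γ`
      (∀ k ∈ Finset.Icc 2 (2 * p.natDegree + 1), (ℓ k).natDegree ≤ k - 2) ∧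
      (∀ (N : ℕ) (β : ℝ), 1 ≤ N → 0 < β →
        varLN N β (N / γ) p =
          ∑ k ∈ Finset.Icc 2 (2 * p.natDegree + 1), β * (ℓ k).eval β / (β * N) ^ k) ∧
      -- the limits along all `β = β_N`, `M = M_N` with `N / M_N → γ`
      (∀ β M : ℕ → ℝ, (∀ N, 1 ≤ N → 0 < β N) → (∀ N : ℕ, 1 ≤ N → (N : ℝ) - 1 < M N) →
        Tendsto (fun N : ℕ => (N : ℝ) / M N) atTop (𝓝 γ) →
        (Tendsto (fun N : ℕ => β N * N) atTop atTop →
          Tendsto (fun N : ℕ => β N * (N : ℝ) ^ 2 * varLN N (β N) (M N) p) atTop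
            (𝓝 (sigmaSq γ (fun x => p.eval x)))) ∧
        (∀ c : ℝ, 0 < c → Tendsto (fun N : ℕ => β N * N) atTop (𝓝 (2 * c)) →
          Tendsto (fun N : ℕ => β N * (N : ℝ) ^ 2 * varLN N (β N) (M N) p) atTop
            (𝓝 (sigmaSqOfExpansion ℓ p.natDegree c)))) := by
  refine ⟨fun N β M hN hβ hM => ⟨isProbabilityMeasure_laguerreEnsemble hN hβ hM,
    memLp_linearStatistic hN hβ hM p⟩, ?_⟩
  obtain ⟨ℓ, hdeg, hℓ⟩ := exists_expansion γ p
  refine ⟨ℓ, fun k _ => hdeg k, fun N β hN hβ => ?_, fun β M hβ hM hγ => ⟨fun h => ?_, fun c hc h => ?_⟩⟩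
  · have hN0 : (0 : ℝ) < N := by positivity
    have hM : (N : ℝ) - 1 < N / γ := by
      have : (N : ℝ) ≤ N / γ := by rw [le_div_iff₀ hγ0]; nlinarith
      linarith
    have e1 : (N : ℝ) / (N / γ) = γ := by field_simp
    have e2 : (1 : ℝ) / N = β * (1 / (β * N)) := by field_simp
    rw [varLN_eq hN hβ hM, e1, e2, loopVariance, hℓ, Finset.mul_sum]
    refine Finset.sum_congr rfl fun k hk => ?_
    obtain ⟨j, rfl⟩ := Nat.exists_eq_add_of_le (Finset.mem_Icc.1 hk).1
    rw [Nat.add_sub_cancel_left, one_div, inv_pow, pow_add]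
    field_simp
  · have h0 : Tendsto (fun N : ℕ => 1 / (β N * N)) atTop (𝓝 0) := by
      simp only [one_div]
      exact h.inv_tendsto_atTop
    have := tendsto_rescaled_varLN p hβ hM hγ h0
    rwa [loopVariance, ← limitCov_eq_sum_coeff, limitCov_eq_sigmaSq hγ0] at this
  · have h0 : Tendsto (fun N : ℕ => 1 / (β N * N)) atTop (𝓝 (1 / (2 * c))) :=
      tendsto_const_nhds.div h (by positivity)
    have := tendsto_rescaled_varLN p hβ hM hγ h0
    rw [loopVariance, ← zero_mul (1 / (2 * c)), hℓ] at this
    convert! this using 2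
    refine Finset.sum_congr rfl fun k _ => ?_
    rw [one_div, inv_pow, div_eq_mul_inv]
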